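/- Let $G$ be a directed graph (loops and parallel edges allowed). A \emph{virtual graph diagram} of $G$ is a generic immersion of $G$ in the plane (vertices go to distinct points, edges are disjoint from the vertices in their interior, and edges meet only in finitely many transverse double points in their interiors), considered up to planar isotopy, in which every double point is marked either as a classical crossing, with a choice of upper and lower strand, or as a virtual crossing. It is \emph{classical} if it has no virtual crossings. Two virtual graph diagrams of $G$ are \emph{virtually equivalent} if they are related by a finite sequence of planar isotopies and the following local moves and their inverses: removing a curl with one crossing, classical or virtual; pulling apart two strands that form a bigon with two crossings, which are either both virtual, or both classical with the same strand on top; moving a strand past a crossing of two other strands (third Reidemeister move), where the three crossings are all classical (and come from three strands at different heights), or all virtual, or the moving strand crosses both of the others virtually and the crossing of those two is classical; moving a strand past a vertex, where the strand is above all, below all, or crosses virtually all of the edges that it meets; and twisting two cyclically neighbouring edges at a vertex around each other by one classical crossing. (Exchanging two neighbouring edges at a vertex by a virtual crossing, and third moves with exactly one virtual crossing, are not allowed.) The \emph{Gauss code} of a virtual graph diagram consists of, for every edge, the sequence of the classical crossings met when the edge is traversed from its initial to its final vertex, each recorded by its name, by whether it is passed on the upper or on the lower strand, and by its sign, together with,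 for every vertex, the counterclockwise cyclic order of the half-edges at it. Virtual crossings are ignored, and the code is considered up to renaming the crossings. A Gauss code on $G$ is \emph{realizable} if it is the Gauss code of a classical diagram of $G$. If the Gauss code of a virtual graph diagram $D$ of $G$ is realizable, then $D$ is virtually equivalent to a classical graph diagram of $G$. -/

import Mathlib

/-!
Virtual spatial graph diagrams.

A diagram in the plane is put in general position with respect to the height function and cut
by horizontal lines into slices, each containing exactly one elementary piece: a local minimum,
a local maximum, a crossing (classical or virtual), or a vertex; all other strands of the slice are
vertical.  So a diagram is a list of slices, read from bottom to top.  Every strand carries the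
name of the edge of the graph it belongs to and its direction (upwards or downwards).
Planar isotopy is then generated by local rules, and so are the Reidemeister moves.
-/

namespace VirtualGraph

/-- A directed graph with vertices `V` and edges `E` (loops and parallel edges are allowed). -/
structure DirectedGraph (V E : Type*) where
  src : E → V
  tgt : E → V

/-- A strand at a horizontal line: its edge, and whether the edge is directed upwards there. -/
abbrev Strand (E : Type*) := E × Bool

/-- The same edge, running in the opposite vertical direction. -/
def rev {E : Type*} (x : Strand E) : Strand E := (x.1, !x.2)

/-- A half-edge: `(e, true)` is the initial half of `e`, `(e, false)` is its final half. -/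
abbrev HalfEdge (E : Type*) := E × Bool

/-- The vertex at which a half-edge is attached. -/
def DirectedGraph.foot {V E : Type*} (G : DirectedGraph V E) (h : HalfEdge E) : V :=
  if h.2 then G.src h.1 else G.tgt h.1

/-- Crossing types.  In a crossing one strand runs from bottom left to top right, the other one
from bottom right to top left; `upper` means that the former is the upper strand, `lower` that it
is the lower strand. -/
inductive CrossingType
  | upper
  | lower
  | virt
  deriving DecidableEq

/-- Exchange upper and lower strand; virtual crossings stay virtual. -/
def CrossingType.flip : CrossingType → CrossingType
  | upper => lower
  | lower => upper
  | virt => virt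

/-- Elementary pieces, with the strands at their bottom and top listed from left to right:
* `cup x`: a local minimum, from `[]` to `[x, rev x]`;
* `cap x`: a local maximum, from `[x, rev x]` to `[]`;
* `cross t x y`: a crossing, from `[x, y]` to `[y, x]`;
* `vertex v below above`: the vertex `v`, from `below` to `above`. -/
inductive Piece (V E : Type*)
  | cup (x : Strand E)
  | cap (x : Strand E)
  | cross (t : CrossingType) (x y : Strand E)
  | vertex (v : V) (below above : List (Strand E))

/-- Strands at the bottom of a piece. -/
def Piece.dom {V E : Type*} : Piece V E → List (Strand E)
  | cup _ => []
  | cap x => [x, rev x]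
  | cross _ x y => [x, y]
  | vertex _ below _ => below

/-- Strands at the top of a piece. -/
def Piece.cod {V E : Type*} : Piece V E → List (Strand E)
  | cup x => [x, rev x]
  | cap _ => []
  | cross _ x y => [y, x]
  | vertex _ _ above => above

/-- A slice: one elementary piece with vertical strands to its left and to its right. -/
structure Slice (V E : Type*) where
  left : List (Strand E)
  piece : Piece V E
  right : List (Strand E)

def Slice.dom {V E : Type*} (s : Slice V E) : List (Strand E) := s.left ++ s.piece.dom ++ s.right

def Slice.cod {V E : Type*} (s : Slice V E) : List (Strand E) := s.left ++ s.piece.cod ++ s.right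

/-- Add vertical strands `a` on the left and `b` on the right. -/
def Slice.whisker {V E : Type*} (a b : List (Strand E)) (s : Slice V E) : Slice V E :=
  ⟨a ++ s.left, s.piece, s.right ++ b⟩

/-- `Fits a w b`: the slices of `w` can be stacked on top of each other, starting with the
strands `a` at the bottom and ending with the strands `b` at the top. -/
def Fits {V E : Type*} : List (Strand E) → List (Slice V E) → List (Strand E) → Prop
  | a, [], b => a = b
  | a, s :: w, b => s.dom = a ∧ Fits s.cod w b

/-- A closed picture in the plane (nothing leaves it at the bottom or at the top). -/
structure Picture (V E : Type*) where
  word : List (Slice V E)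
  fits : Fits [] word []

/-! ### Following strands -/

/-- Follow a strand through a piece.  It enters through the top (`true`) or the bottom (`false`) at
the given position (counted from the left, starting with `0`).  The result is the side and the
position where it leaves the piece and, if it has passed a classical crossing, whether it was the
upper strand there; the result is `none` if the strand ends at a vertex. -/
def Piece.follow {V E : Type*} : Piece V E → Bool → ℕ → Option (Bool × ℕ × Option Bool)
  | cup _, b, i => some (b, 1 - i, none)
  | cap _, b, i => some (b, 1 - i, none)
  | cross t _ _, b, i =>
      some (!b, 1 - i,
        match t with
        | .virt => none
        -- the strand from bottom left to top right is the one with `b = false`, `i = 0`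
        -- or `b = true`, `i = 1`
        | .upper => some (b == (i == 1))
        | .lower => some (!(b == (i == 1))))
  | vertex _ _ _, _, _ => none

/-- Number of ends of a piece at its top (`true`) or bottom (`false`). -/
def Piece.arity {V E : Type*} (p : Piece V E) (b : Bool) : ℕ :=
  if b then p.cod.length else p.dom.length

/-- Follow a strand through a slice, with the same conventions as for `Piece.follow`. -/
def Slice.follow {V E : Type*} (s : Slice V E) (b : Bool) (j : ℕ) :
    Option (Bool × ℕ × Option Bool) :=
  if j < s.left.length then some (!b, j, none)
  else if j < s.left.length + s.piece.arity b then
    (s.piece.follow b (j - s.left.length)).map fun r => (r.1, s.left.length + r.2.1, r.2.2)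
  else some (!b, j - s.piece.arity b + s.piece.arity (!b), none)

/-- The sign of a crossing (`true` for positive): a crossing of two upward strands in which the
strand from bottom left to top right is the upper one is positive, and reversing one of the two
strands or exchanging upper and lower strand changes the sign. -/
def Piece.sign {V E : Type*} : Piece V E → Bool
  | cross t x y => (t == .upper) == (x.2 == y.2)
  | _ => false

/-- A letter of a Gauss code: the name of the crossing, whether it is passed on the upper strand,
and the sign of the crossing (`true` for positive). -/
structure Letter where
  name : ℕ
  isOver : Bool
  isPos : Bool

/-- The slice entered by a strand that leaves slice `k` through the top (`true`) or the bottom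
(`false`).  (In a closed picture no strand leaves slice `0` through the bottom.) -/
def nextIndex (k : ℕ) (b : Bool) : ℕ := if b then k + 1 else k - 1

/-- `Trace w k b j l`: the strand which leaves the `k`-th slice of `w` through the top (`b = true`)
or bottom (`b = false`) at position `j` ends, when followed from there, at a vertex, and the
classical crossings met on the way are listed in `l`; a crossing is named by the index of its slice.
Virtual crossings are ignored. -/
inductive Trace {V E : Type*} (w : List (Slice V E)) : ℕ → Bool → ℕ → List Letter → Prop
  | finish {k : ℕ} {b : Bool} {j : ℕ} {s : Slice V E} :
      w[nextIndex k b]? = some s → s.follow (!b) j = none → Trace w k b j []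
  | pass {k : ℕ} {b : Bool} {j : ℕ} {s : Slice V E} {b' : Bool} {j' : ℕ} {l : List Letter} :
      w[nextIndex k b]? = some s → s.follow (!b) j = some (b', j', none) →
      Trace w (nextIndex k b) b' j' l → Trace w k b j l
  | meet {k : ℕ} {b : Bool} {j : ℕ} {s : Slice V E} {b' : Bool} {j' : ℕ} {o : Bool}
      {l : List Letter} :
      w[nextIndex k b]? = some s → s.follow (!b) j = some (b', j', some o) →
      Trace w (nextIndex k b) b' j' l →
      Trace w k b j (⟨nextIndex k b, o, s.piece.sign⟩ :: l)

/-- `EdgeTrace w e l`: the edge `e`, followed from its initial vertex to its final vertex, meets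
the sequence `l` of classical crossings.  (At a vertex, an edge starts at a strand above the vertex
that is directed upwards or at a strand below the vertex that is directed downwards.) -/
inductive EdgeTrace {V E : Type*} (w : List (Slice V E)) (e : E) : List Letter → Prop
  | up {k i : ℕ} {v : V} {left below above right : List (Strand E)} {l : List Letter} :
      w[k]? = some ⟨left, .vertex v below above, right⟩ → above[i]? = some (e, true) →
      Trace w k true (left.length + i) l → EdgeTrace w e l
  | down {k i : ℕ} {v : V} {left below above right : List (Strand E)} {l : List Letter} :
      w[k]? = some ⟨left, .vertex v below above, right⟩ → below[i]? = some (e, false) →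
      Trace w k false (left.length + i) l → EdgeTrace w e l

/-! ### Diagrams -/

/-- If the slice contains a vertex: the vertex, and the half-edges attached to it in
counterclockwise order (the ones below from left to right, then those above from right to left). -/
def Slice.star {V E : Type*} (s : Slice V E) : Option (V × List (HalfEdge E)) :=
  match s.piece with
  | .vertex v below above => some (v, below.map rev ++ above.reverse)
  | _ => none

/-- All vertices of a picture, with their half-edges in counterclockwise order. -/
def stars {V E : Type*} (w : List (Slice V E)) : List (V × List (HalfEdge E)) :=
  w.filterMap Slice.star

/-- A virtual graph diagram of the directed graph `G`. -/
structure Diagram {V E : Type*} (G : DirectedGraph V E) extends Picture V E where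
  /-- no vertex is drawn twice -/
  vertex_nodup : ((stars word).map Prod.fst).Nodup
  /-- every vertex is drawn -/
  vertex_mem : ∀ v : V, ∃ h, (v, h) ∈ stars word
  /-- the half-edges at `v` are drawn once each, and nothing else is attached at `v` -/
  star_nodup : ∀ v h, (v, h) ∈ stars word → h.Nodup
  star_mem : ∀ v h, (v, h) ∈ stars word → ∀ x : HalfEdge E, x ∈ h ↔ G.foot x = v
  /-- there are no closed curves without vertices: every strand, followed from the top of
  any slice, ends at a vertex -/
  no_circle : ∀ (k : ℕ) (s : Slice V E), word[k]? = some s → ∀ j < s.cod.length,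
    ∃ l, Trace word k true j l

/-- A classical graph diagram: a diagram without virtual crossings. -/
def Diagram.IsClassical {V E : Type*} {G : DirectedGraph V E} (D : Diagram G) : Prop :=
  ∀ s ∈ D.word, ∀ x y, s.piece ≠ .cross .virt x y

/-! ### Gauss codes -/

/-- A Gauss code on a vertex-oriented directed graph: a word for every edge and a cyclic order
of half-edges (counterclockwise) for every vertex. -/
structure GaussCode (V E : Type*) where
  word : E → List Letter
  rotation : V → Cycle (HalfEdge E)

/-- `S` is a Gauss code of `D`: after distinct names have been given to the crossings, the word of
an edge is the sequence of the classical crossings met along it, and the cyclic order at a vertex is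
the one in the diagram. -/
def Diagram.HasGaussCode {V E : Type*} {G : DirectedGraph V E} (D : Diagram G)
    (S : GaussCode V E) : Prop :=
  (∃ f : ℕ → ℕ, f.Injective ∧ ∀ e : E, ∃ l, EdgeTrace D.word e l ∧
    S.word e = l.map fun a => { a with name := f a.name }) ∧
  ∀ v h, (v, h) ∈ stars D.word → S.rotation v = (h : Cycle (HalfEdge E))

/-- A Gauss code is realizable if it is the Gauss code of a classical diagram of `G`. -/
def GaussCode.Realizable {V E : Type*} (S : GaussCode V E) (G : DirectedGraph V E) : Prop :=
  ∃ D : Diagram G, D.IsClassical ∧ D.HasGaussCode S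

/-! ### Moves -/

/-- Which triangles may be reversed by a Reidemeister move of the third kind.  The strands
`x, y, z` start from left to right, and the arguments are the types of the crossings of `x` with `y`,
of `x` with `z`, and of `y` with `z`. -/
def TriangleAllowed : CrossingType → CrossingType → CrossingType → Prop
  -- purely virtual
  | .virt, .virt, .virt => True
  -- one classical crossing, and a strand meeting the two others virtually
  | _, .virt, .virt => True
  | .virt, _, .virt => True
  | .virt, .virt, _ => True
  -- forbidden: exactly one virtual crossing
  | .virt, _, _ => False
  | _, .virt, _ => False
  | _, _, .virt => False
  -- classical: no strand would have to be cyclically above the others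
  | .upper, .lower, .upper => False
  | .lower, .upper, .lower => False
  | _, _, _ => True

/-- The strand `y` moves from the left of the strands in the list to their right; all crossings
have type `t`, where `upper` means that `y` is the upper strand. -/
def passRight {V E : Type*} (t : CrossingType) (y : Strand E) : List (Strand E) → List (Slice V E)
  | [] => []
  | z :: zs => ⟨[], .cross t y z, zs⟩ :: (passRight t y zs).map (Slice.whisker [z] [])

/-- Planar isotopy. -/
inductive PlanarRule {V E : Type*} : List (Slice V E) → List (Slice V E) → Prop
  /-- two pieces next to each other exchange their heights -/
  | interchange (p q : Piece V E) (m : List (Strand E)) :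
      PlanarRule [⟨[], p, m ++ q.dom⟩, ⟨p.cod ++ m, q, []⟩]
        [⟨p.dom ++ m, q, []⟩, ⟨[], p, m ++ q.cod⟩]
  /-- a local maximum cancels a local minimum -/
  | zigzagLeft (x : Strand E) :
      PlanarRule [⟨[x], .cup (rev x), []⟩, ⟨[], .cap x, [x]⟩] []
  | zigzagRight (x : Strand E) :
      PlanarRule [⟨[], .cup x, [x]⟩, ⟨[x], .cap (rev x), []⟩] []
  /-- a crossing slides through a local maximum -/
  | slideCap (t : CrossingType) (x y : Strand E) :
      PlanarRule [⟨[x], .cross t y (rev x), []⟩, ⟨[], .cap x, [y]⟩]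
        [⟨[], .cross t.flip x y, [rev x]⟩, ⟨[y], .cap x, []⟩]
  /-- a crossing slides through a local minimum -/
  | slideCup (t : CrossingType) (x y : Strand E) :
      PlanarRule [⟨[], .cup x, [y]⟩, ⟨[x], .cross t (rev x) y, []⟩]
        [⟨[y], .cup x, []⟩, ⟨[], .cross t.flip y x, [rev x]⟩]
  /-- the leftmost or rightmost edge at the top of a vertex is bent down -/
  | bendLeft (v : V) (below above : List (Strand E)) (x : Strand E) :
      PlanarRule [⟨[], .vertex v below (x :: above), []⟩]
        [⟨[], .cup x, below⟩, ⟨[x], .vertex v (rev x :: below) above, []⟩]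
  | bendRight (v : V) (below above : List (Strand E)) (x : Strand E) :
      PlanarRule [⟨[], .vertex v below (above ++ [x]), []⟩]
        [⟨below, .cup (rev x), []⟩, ⟨[], .vertex v (below ++ [rev x]) above, [x]⟩]

/-- The Reidemeister moves for virtual graph diagrams.  Where the crossing type `t` is arbitrary,
the rule comprises the classical move and its purely virtual version. -/
inductive ReidemeisterRule {V E : Type*} : List (Slice V E) → List (Slice V E) → Prop
  /-- first move: removing a curl -/
  | curlRight (t : CrossingType) (x : Strand E) :
      ReidemeisterRule
        [⟨[x], .cup x, []⟩, ⟨[], .cross t x x, [rev x]⟩, ⟨[x], .cap x, []⟩] []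
  | curlLeft (t : CrossingType) (x : Strand E) :
      ReidemeisterRule
        [⟨[], .cup (rev x), [x]⟩, ⟨[rev x], .cross t x x, []⟩, ⟨[], .cap (rev x), [x]⟩] []
  /-- second move: pulling two strands apart -/
  | bigon (t : CrossingType) (x y : Strand E) :
      ReidemeisterRule [⟨[], .cross t x y, []⟩, ⟨[], .cross t.flip y x, []⟩] []
  /-- third move (classical, virtual, or a virtual strand sliding past a classical crossing) -/
  | triangle (t₁ t₂ t₃ : CrossingType) (h : TriangleAllowed t₁ t₂ t₃) (x y z : Strand E) :
      ReidemeisterRule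
        [⟨[], .cross t₁ x y, [z]⟩, ⟨[y], .cross t₂ x z, []⟩, ⟨[], .cross t₃ y z, [x]⟩]
        [⟨[x], .cross t₃ y z, []⟩, ⟨[], .cross t₂ x z, [y]⟩, ⟨[z], .cross t₁ x y, []⟩]
  /-- fourth move: a strand slides over, under, or virtually past a vertex -/
  | pastVertex (t : CrossingType) (y : Strand E) (v : V) (below above : List (Strand E)) :
      ReidemeisterRule (passRight t y below ++ [⟨[], .vertex v below above, [y]⟩])
        (⟨[y], .vertex v below above, []⟩ :: passRight t y above)
  /-- fifth move: two neighbouring edges at a vertex are twisted around each other by a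
  classical crossing (the virtual version is forbidden) -/
  | twist (t : CrossingType) (ht : t ≠ .virt) (v : V) (below l r : List (Strand E))
      (x y : Strand E) :
      ReidemeisterRule [⟨[], .vertex v below (l ++ x :: y :: r), []⟩, ⟨l, .cross t x y, r⟩]
        [⟨[], .vertex v below (l ++ y :: x :: r), []⟩]

/-- A single move: some consecutive slices, up to vertical strands `a` on the left and `b` on the
right, are replaced according to one of the rules. -/
inductive Move {V E : Type*} : Picture V E → Picture V E → Prop
  | planar {P Q : Picture V E} (p q L R : List (Slice V E)) (a b : List (Strand E)) :
      PlanarRule L R → P.word = p ++ L.map (Slice.whisker a b) ++ q →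
      Q.word = p ++ R.map (Slice.whisker a b) ++ q → Move P Q
  | reidemeister {P Q : Picture V E} (p q L R : List (Slice V E)) (a b : List (Strand E)) :
      ReidemeisterRule L R → P.word = p ++ L.map (Slice.whisker a b) ++ q →
      Q.word = p ++ R.map (Slice.whisker a b) ++ q → Move P Q

/-- Virtual equivalence: the equivalence relation generated by planar isotopy and the Reidemeister
moves.  (The moves are local and do not change the underlying graph, so every picture obtained from
a diagram of `G` by moves is again a diagram of `G`.) -/
def VirtuallyEquivalent {V E : Type*} {G : DirectedGraph V E} (D D' : Diagram G) : Prop :=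
  Relation.EqvGen Move D.toPicture D'.toPicture

end VirtualGraph

/-!
Push every crossing and every vertex up by bending its strands so that all of them leave at the
top: the diagram becomes a row of such *nodes* followed by a word of caps and virtual crossings.
A strand can be moved virtually past anything, so a word of caps and virtual crossings is determined
up to equivalence by which of its end points it connects, and nodes can be permuted and rotated
freely. Hence only the nodes and the connections between them matter. Labelling each strand of a
node by its edge and the number of classical crossings left on that edge reads the connections off
the Gauss code, so two diagrams with the same code have, up to rotations, the same labelled nodes.
The nodes need never be flipped and their strands never be exchanged, which is why the forbidden
moves do not occur.
-/

namespace VirtualGraph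

variable {V E F : Type*}

@[simp] theorem rev_rev (x : Strand E) : rev (rev x) = x := by
  simp [rev]

theorem rev_ne (x : Strand E) : rev x ≠ x := by
  simp [rev, Prod.ext_iff]

@[simp] theorem CrossingType.flip_virt : CrossingType.virt.flip = .virt := rfl

@[simp] theorem CrossingType.flip_flip (t : CrossingType) : t.flip.flip = t := by
  cases t <;> rfl

namespace Piece

@[simp] theorem dom_cup (x : Strand E) : (cup x : Piece V E).dom = [] := rfl

@[simp] theorem dom_cap (x : Strand E) : (cap x : Piece V E).dom = [x, rev x] := rfl

@[simp] theorem dom_cross (t : CrossingType) (x y : Strand E) :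
    (cross t x y : Piece V E).dom = [x, y] := rfl

@[simp] theorem dom_vertex (v : V) (below above : List (Strand E)) :
    (vertex v below above).dom = below := rfl

@[simp] theorem cod_cup (x : Strand E) : (cup x : Piece V E).cod = [x, rev x] := rfl

@[simp] theorem cod_cap (x : Strand E) : (cap x : Piece V E).cod = [] := rfl

@[simp] theorem cod_cross (t : CrossingType) (x y : Strand E) :
    (cross t x y : Piece V E).cod = [y, x] := rfl

@[simp] theorem cod_vertex (v : V) (below above : List (Strand E)) :
    (vertex v below above).cod = above := rfl

end Piece

@[simp] theorem Slice.dom_mk (l r : List (Strand E)) (p : Piece V E) :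
    (⟨l, p, r⟩ : Slice V E).dom = l ++ (p.dom ++ r) := by
  simp [Slice.dom]

@[simp] theorem Slice.cod_mk (l r : List (Strand E)) (p : Piece V E) :
    (⟨l, p, r⟩ : Slice V E).cod = l ++ (p.cod ++ r) := by
  simp [Slice.cod]

/-- Add vertical strands `l` on the left and `r` on the right of all slices of a word. -/
def whiskerWord (l : List (Strand E)) (u : List (Slice V E)) (r : List (Strand E)) :
    List (Slice V E) :=
  u.map (Slice.whisker l r)

variable {a b c d : List (Strand E)} {u u' v v' w : List (Slice V E)}

@[simp] theorem whiskerWord_nil (l r : List (Strand E)) :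
    whiskerWord l ([] : List (Slice V E)) r = [] := rfl

@[simp] theorem whiskerWord_cons (l r : List (Strand E)) (s : Slice V E) (u : List (Slice V E)) :
    whiskerWord l (s :: u) r = ⟨l ++ s.left, s.piece, s.right ++ r⟩ :: whiskerWord l u r := rfl

@[simp] theorem whiskerWord_append (l r : List (Strand E)) (u v : List (Slice V E)) :
    whiskerWord l (u ++ v) r = whiskerWord l u r ++ whiskerWord l v r :=
  List.map_append

@[simp] theorem whiskerWord_whiskerWord (l l' r r' : List (Strand E)) (u : List (Slice V E)) :
    whiskerWord l (whiskerWord l' u r') r = whiskerWord (l ++ l') u (r' ++ r) := by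
  simp [whiskerWord, Slice.whisker]

@[simp] theorem whiskerWord_nil_nil (u : List (Slice V E)) : whiskerWord [] u [] = u := by
  induction u with
  | nil => rfl
  | cons s u ih => simp [ih]

@[simp] theorem fits_nil : Fits a ([] : List (Slice V E)) b ↔ a = b := Iff.rfl

@[simp] theorem fits_cons {s : Slice V E} : Fits a (s :: w) b ↔ s.dom = a ∧ Fits s.cod w b :=
  Iff.rfl

theorem fits_append_iff : Fits a (u ++ v) c ↔ ∃ b, Fits a u b ∧ Fits b v c := by
  induction u generalizing a with
  | nil => simp
  | cons s u ih => simp [ih, and_assoc]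

theorem Fits.append (hu : Fits a u b) (hv : Fits b v c) : Fits a (u ++ v) c :=
  fits_append_iff.2 ⟨b, hu, hv⟩

theorem Fits.whisker (h : Fits a u b) (l r : List (Strand E)) :
    Fits (l ++ a ++ r) (whiskerWord l u r) (l ++ b ++ r) := by
  induction u generalizing a with
  | nil => simpa using h
  | cons s u ih =>
    obtain ⟨rfl, hu⟩ := h
    rw [whiskerWord_cons, fits_cons]
    exact ⟨by simp [Slice.dom], by simpa [Slice.cod] using ih hu⟩

theorem Fits.whisker_left (h : Fits a u b) (l : List (Strand E)) :
    Fits (l ++ a) (whiskerWord l u []) (l ++ b) := by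
  simpa using h.whisker l []

theorem Fits.whisker_right (h : Fits a u b) (r : List (Strand E)) :
    Fits (a ++ r) (whiskerWord [] u r) (b ++ r) :=
  h.whisker [] r

theorem Piece.fits (p : Piece V E) : Fits p.dom [⟨[], p, []⟩] p.cod := by
  simp

theorem Slice.fits (s : Slice V E) : Fits s.dom [s] s.cod :=
  ⟨rfl, rfl⟩

/-- The local rules: planar isotopy and Reidemeister moves. -/
def Rule (L R : List (Slice V E)) : Prop := PlanarRule L R ∨ ReidemeisterRule L R

/-- Virtual equivalence of words, that is of pictures with the strands `a` at the bottom and the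
strands `b` at the top.  All words that occur on the way are required to fit. -/
inductive Eqv (a b : List (Strand E)) : List (Slice V E) → List (Slice V E) → Prop
  | refl {w : List (Slice V E)} : Fits a w b → Eqv a b w w
  | step {L R : List (Slice V E)} (p q : List (Slice V E)) (l r : List (Strand E)) :
      Rule L R → Fits a (p ++ whiskerWord l L r ++ q) b →
      Fits a (p ++ whiskerWord l R r ++ q) b →
      Eqv a b (p ++ whiskerWord l L r ++ q) (p ++ whiskerWord l R r ++ q)
  | symm {u v : List (Slice V E)} : Eqv a b u v → Eqv a b v u
  | trans {u v w : List (Slice V E)} : Eqv a b u v → Eqv a b v w → Eqv a b u w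

namespace Eqv

attribute [symm] Eqv.symm
attribute [trans] Eqv.trans

theorem fits (h : Eqv a b u v) : Fits a u b ∧ Fits a v b := by
  induction h with
  | refl h => exact ⟨h, h⟩
  | step _ _ _ _ _ hL hR => exact ⟨hL, hR⟩
  | symm _ ih => exact ih.symm
  | trans _ _ ih₁ ih₂ => exact ⟨ih₁.1, ih₂.2⟩

theorem eqvGen_move {P Q : Picture V E} (h : Eqv [] [] P.word Q.word) :
    Relation.EqvGen Move P Q := by
  obtain ⟨u, hu⟩ := P
  obtain ⟨v, hv⟩ := Q
  change Eqv [] [] u v at h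
  induction h with
  | refl => exact .refl _
  | step p q l r hr =>
    rcases hr with hr | hr
    · exact .rel _ _ (.planar p q _ _ l r hr rfl rfl)
    · exact .rel _ _ (.reidemeister p q _ _ l r hr rfl rfl)
  | symm _ ih => exact (ih hv hu).symm
  | trans h _ ih₁ ih₂ => exact (ih₁ hu h.fits.2).trans _ _ _ (ih₂ h.fits.2 hv)

theorem of_rule {L R : List (Slice V E)} (h : Rule L R) (hL : Fits a L b := by simp)
    (hR : Fits a R b := by simp) : Eqv a b L R := by
  simpa using Eqv.step (a := a) (b := b) [] [] [] [] h (by simpa using hL) (by simpa using hR)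

theorem append_left (hu : Fits a u b) (h : Eqv b c v v') : Eqv a c (u ++ v) (u ++ v') := by
  induction h with
  | refl h => exact .refl (hu.append h)
  | step p q l r hr hL hR =>
    simpa using Eqv.step (u ++ p) q l r hr (by simpa using hu.append hL)
      (by simpa using hu.append hR)
  | symm _ ih => exact ih.symm
  | trans _ _ ih₁ ih₂ => exact ih₁.trans ih₂

theorem append_right (h : Eqv a b u u') (hv : Fits b v c) : Eqv a c (u ++ v) (u' ++ v) := by
  induction h with
  | refl h => exact .refl (h.append hv)
  | step p q l r hr hL hR =>
    simpa using Eqv.step p (q ++ v) l r hr (by simpa using hL.append hv)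
      (by simpa using hR.append hv)
  | symm _ ih => exact ih.symm
  | trans _ _ ih₁ ih₂ => exact ih₁.trans ih₂

theorem append (h : Eqv a b u u') (h' : Eqv b c v v') : Eqv a c (u ++ v) (u' ++ v') :=
  (h.append_right h'.fits.1).trans (h'.append_left h.fits.2)

theorem cons (s : Slice V E) (h : Eqv s.cod b u v) : Eqv s.dom b (s :: u) (s :: v) :=
  h.append_left s.fits

theorem concat (s : Slice V E) (h : Eqv a s.dom u v) : Eqv a s.cod (u ++ [s]) (v ++ [s]) :=
  h.append_right s.fits

theorem whisker (h : Eqv a b u u') (l r : List (Strand E)) :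
    Eqv (l ++ a ++ r) (l ++ b ++ r) (whiskerWord l u r) (whiskerWord l u' r) := by
  induction h with
  | refl h => exact .refl (h.whisker l r)
  | step p q l' r' hr hL hR =>
    simpa using Eqv.step (whiskerWord l p r) (whiskerWord l q r) (l ++ l') (r' ++ r) hr
      (by simpa using hL.whisker l r) (by simpa using hR.whisker l r)
  | symm _ ih => exact ih.symm
  | trans _ _ ih₁ ih₂ => exact ih₁.trans ih₂

theorem whisker_left (h : Eqv a b u u') (l : List (Strand E)) :
    Eqv (l ++ a) (l ++ b) (whiskerWord l u []) (whiskerWord l u' []) := by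
  simpa using h.whisker l []

theorem whisker_right (h : Eqv a b u u') (r : List (Strand E)) :
    Eqv (a ++ r) (b ++ r) (whiskerWord [] u r) (whiskerWord [] u' r) :=
  h.whisker [] r

/-! ### Interchange -/

theorem interchange_piece (p q : Piece V E) (m : List (Strand E)) :
    Eqv (p.dom ++ (m ++ q.dom)) (p.cod ++ (m ++ q.cod))
      [⟨[], p, m ++ q.dom⟩, ⟨p.cod ++ m, q, []⟩] [⟨p.dom ++ m, q, []⟩, ⟨[], p, m ++ q.cod⟩] :=
  .of_rule (.inl (.interchange p q m))

theorem interchange_slice (s s' : Slice V E) :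
    Eqv (s.dom ++ s'.dom) (s.cod ++ s'.cod)
      [⟨s.left, s.piece, s.right ++ s'.dom⟩, ⟨s.cod ++ s'.left, s'.piece, s'.right⟩]
      [⟨s.dom ++ s'.left, s'.piece, s'.right⟩, ⟨s.left, s.piece, s.right ++ s'.cod⟩] := by
  simpa [Slice.dom, Slice.cod] using
    (interchange_piece s.piece s'.piece (s.right ++ s'.left)).whisker s.left s'.right

theorem interchange_slice_word (s : Slice V E) (hv : Fits c v d) :
    Eqv (s.dom ++ c) (s.cod ++ d) (⟨s.left, s.piece, s.right ++ c⟩ :: whiskerWord s.cod v [])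
      (whiskerWord s.dom v [] ++ [⟨s.left, s.piece, s.right ++ d⟩]) := by
  induction v generalizing c with
  | nil =>
    obtain rfl := hv
    simpa using Eqv.refl (s.fits.whisker_right c)
  | cons s' v ih =>
    obtain ⟨rfl, hv⟩ := hv
    trans ([⟨s.dom ++ s'.left, s'.piece, s'.right⟩] ++
        ⟨s.left, s.piece, s.right ++ s'.cod⟩ :: whiskerWord s.cod v [])
    · simpa using (interchange_slice s s').append_right (hv.whisker_left s.cod)
    · simpa using (ih hv).append_left (s'.fits.whisker_left s.dom)

theorem interchange (hu : Fits a u b) (hv : Fits c v d) :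
    Eqv (a ++ c) (b ++ d) (whiskerWord [] u c ++ whiskerWord b v [])
      (whiskerWord a v [] ++ whiskerWord [] u d) := by
  induction u generalizing a with
  | nil =>
    obtain rfl := hu
    simpa using Eqv.refl (hv.whisker_left a)
  | cons s u ih =>
    obtain ⟨rfl, hu⟩ := hu
    trans ([⟨s.left, s.piece, s.right ++ c⟩] ++ (whiskerWord s.cod v [] ++ whiskerWord [] u d))
    · simpa using (ih hu).append_left (s.fits.whisker_right c)
    · simpa using (interchange_slice_word s hv).append_right (hu.whisker_right d)

/-! ### A strand passing other strands virtually -/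

theorem bigon (t : CrossingType) (x y : Strand E) :
    Eqv [x, y] [x, y]
      ([⟨[], .cross t x y, []⟩, ⟨[], .cross t.flip y x, []⟩] : List (Slice V E)) [] :=
  .of_rule (.inr (.bigon t x y))

theorem slide_cap (t : CrossingType) (x y : Strand E) :
    Eqv [x, y, rev x] [y] ([⟨[x], .cross t y (rev x), []⟩, ⟨[], .cap x, [y]⟩] : List (Slice V E))
      [⟨[], .cross t.flip x y, [rev x]⟩, ⟨[y], .cap x, []⟩] :=
  .of_rule (.inl (.slideCap t x y))

theorem slide_cup (t : CrossingType) (x y : Strand E) :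
    Eqv [y] [x, y, rev x] ([⟨[], .cup x, [y]⟩, ⟨[x], .cross t (rev x) y, []⟩] : List (Slice V E))
      [⟨[y], .cup x, []⟩, ⟨[], .cross t.flip y x, [rev x]⟩] :=
  .of_rule (.inl (.slideCup t x y))

theorem zigzag_left (x : Strand E) :
    Eqv [x] [x] ([⟨[x], .cup (rev x), []⟩, ⟨[], .cap x, [x]⟩] : List (Slice V E)) [] :=
  .of_rule (.inl (.zigzagLeft x))

theorem zigzag_right (x : Strand E) :
    Eqv [x] [x] ([⟨[], .cup x, [x]⟩, ⟨[x], .cap (rev x), []⟩] : List (Slice V E)) [] :=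
  .of_rule (.inl (.zigzagRight x))

end Eqv

theorem passRight_cons (t : CrossingType) (y z : Strand E) (zs : List (Strand E)) :
    (passRight t y (z :: zs) : List (Slice V E)) =
      ⟨[], .cross t y z, zs⟩ :: whiskerWord [z] (passRight t y zs) [] := rfl

@[simp] theorem passRight_nil (t : CrossingType) (y : Strand E) :
    (passRight t y [] : List (Slice V E)) = [] := rfl

theorem passRight_append (t : CrossingType) (y : Strand E) (l m : List (Strand E)) :
    (passRight t y (l ++ m) : List (Slice V E)) =
      whiskerWord [] (passRight t y l) m ++ whiskerWord l (passRight t y m) [] := by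
  induction l with
  | nil => simp
  | cons z l ih => simp [passRight_cons, ih]

theorem fits_passRight (t : CrossingType) (y : Strand E) (zs : List (Strand E)) :
    Fits (y :: zs) (passRight t y zs : List (Slice V E)) (zs ++ [y]) := by
  induction zs with
  | nil => simp
  | cons z zs ih => simpa [passRight_cons] using ih.whisker_left [z]

/-- The strand `y` passes the strands of the list virtually from left to right. -/
abbrev vpass (y : Strand E) (zs : List (Strand E)) : List (Slice V E) := passRight .virt y zs

namespace Eqv

theorem vpass_piece (y : Strand E) (p : Piece V E) :
    Eqv (y :: p.dom) (p.cod ++ [y]) (vpass y p.dom ++ [⟨[], p, [y]⟩])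
      (⟨[y], p, []⟩ :: vpass y p.cod) := by
  cases p with
  | cup x =>
    symm
    trans [⟨[], .cup x, [y]⟩, ⟨[x], .cross .virt (rev x) y, []⟩,
        ⟨[x], .cross .virt y (rev x), []⟩]
    · simpa [passRight_cons] using
        ((slide_cup .virt x y).concat ⟨[x], .cross .virt y (rev x), []⟩).symm
    · simpa using ((bigon .virt (rev x) y).whisker_left [x]).cons ⟨[], .cup x, [y]⟩
  | cap x =>
    trans [⟨[], .cross .virt y x, [rev x]⟩, ⟨[], .cross .virt x y, [rev x]⟩,
        ⟨[y], .cap x, []⟩]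
    · simpa [passRight_cons] using
        (slide_cap .virt x y).cons ⟨[], .cross .virt y x, [rev x]⟩
    · simpa using ((bigon .virt y x).whisker_right [rev x]).concat ⟨[y], .cap x, []⟩
  | cross t x z =>
    simpa [passRight_cons] using Eqv.of_rule (V := V) (a := [y, x, z]) (b := [z, x, y])
      (.inr (.triangle .virt .virt t (by cases t <;> trivial) y x z))
  | vertex v below above =>
    refine .of_rule (.inr (.pastVertex .virt y v below above)) ?_ ?_
    · exact (fits_passRight _ _ _).append (by simp)
    · exact ⟨by simp, by simpa using fits_passRight .virt y above⟩

theorem vpass_slice (y : Strand E) (s : Slice V E) :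
    Eqv (y :: s.dom) (s.cod ++ [y]) (vpass y s.dom ++ [⟨s.left, s.piece, s.right ++ [y]⟩])
      (⟨y :: s.left, s.piece, s.right⟩ :: vpass y s.cod) := by
  obtain ⟨l, p, r⟩ := s
  have fits_l (m) : Fits (y :: (l ++ m)) (whiskerWord [] (vpass y l) m : List (Slice V E))
      (l ++ y :: m) := by
    simpa using (fits_passRight .virt y l).whisker_right m
  have fits_r (m) : Fits (m ++ y :: r) (whiskerWord m (vpass y r) [] : List (Slice V E))
      (m ++ (r ++ [y])) :=
    (fits_passRight .virt y r).whisker_left m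
  have slide_right := ((interchange p.fits (fits_passRight .virt y r)).symm.whisker_left l)
  have slide_piece := (vpass_piece y p).whisker l r
  have slide_left := interchange (fits_passRight .virt y l) (p.fits.whisker_right r)
  trans (whiskerWord [] (vpass y l) (p.dom ++ r) ++ (whiskerWord l (vpass y p.dom) r ++
      (⟨l, p, y :: r⟩ :: whiskerWord (l ++ p.cod) (vpass y r) [])))
  · have fits_dom : Fits (l ++ y :: (p.dom ++ r))
        (whiskerWord l (vpass y p.dom) r : List (Slice V E)) (l ++ (p.dom ++ y :: r)) := by
      simpa using (fits_passRight .virt y p.dom).whisker l r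
    simpa [passRight_append] using
      .append_left (fits_l _) (.append_left fits_dom (by simpa using slide_right))
  trans (whiskerWord [] (vpass y l) (p.dom ++ r) ++ (⟨l ++ [y], p, r⟩ ::
      (whiskerWord l (vpass y p.cod) r ++ whiskerWord (l ++ p.cod) (vpass y r) [])))
  · have := slide_piece.append_right (by simpa using fits_r (l ++ p.cod))
    simpa using .append_left (fits_l _) (by simpa using this)
  · have fits_cod : Fits (l ++ y :: (p.cod ++ r))
        (whiskerWord l (vpass y p.cod) r : List (Slice V E)) (l ++ (p.cod ++ y :: r)) := by
      simpa using (fits_passRight .virt y p.cod).whisker l r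
    have := slide_left.append_right
      (by simpa using fits_cod.append (by simpa using fits_r (l ++ p.cod)))
    simpa [passRight_append] using this

theorem vpass_word (y : Strand E) (hu : Fits a u b) :
    Eqv (y :: a) (b ++ [y]) (vpass y a ++ whiskerWord [] u [y])
      (whiskerWord [y] u [] ++ vpass y b) := by
  induction u generalizing a with
  | nil =>
    obtain rfl := hu
    simpa using Eqv.refl (fits_passRight .virt y a)
  | cons s u ih =>
    obtain ⟨rfl, hu⟩ := hu
    trans (⟨y :: s.left, s.piece, s.right⟩ :: (vpass y s.cod ++ whiskerWord [] u [y]))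
    · simpa using (vpass_slice y s).append_right (hu.whisker_right [y])
    · simpa using (ih hu).append_left (s.fits.whisker_left [y])

end Eqv

/-- The strands `d` pass the strands `c` virtually from left to right. -/
def passBlock : List (Strand E) → List (Strand E) → List (Slice V E)
  | [], _ => []
  | y :: d, c => whiskerWord [y] (passBlock d c) [] ++ whiskerWord [] (vpass y c) d

theorem fits_passBlock (d c : List (Strand E)) :
    Fits (d ++ c) (passBlock d c : List (Slice V E)) (c ++ d) := by
  induction d with
  | nil => simp [passBlock]
  | cons y d ih =>
    exact .append (ih.whisker_left [y]) (by simpa using (fits_passRight .virt y c).whisker_right d)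

@[simp] theorem passBlock_nil (d : List (Strand E)) :
    (passBlock d [] : List (Slice V E)) = [] := by
  induction d with
  | nil => rfl
  | cons y d ih => simp [passBlock, ih]

theorem Eqv.passBlock_word (d : List (Strand E)) (hu : Fits a u b) :
    Eqv (d ++ a) (b ++ d) (passBlock d a ++ whiskerWord [] u d)
      (whiskerWord d u [] ++ passBlock d b) := by
  induction d with
  | nil => simpa [passBlock] using Eqv.refl hu
  | cons y d ih =>
    trans (whiskerWord [y] (passBlock d a) [] ++
        (whiskerWord [y] u d ++ whiskerWord [] (vpass y b) d))
    · have := ((vpass_word y hu).whisker_right d).append_left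
        (by simpa using (fits_passBlock d a).whisker_left [y])
      simpa [passBlock] using this
    · have := (ih.whisker_left [y]).append_right
        (by simpa using (fits_passRight .virt y b).whisker_right d)
      simpa [passBlock] using this

theorem Eqv.passBlock_closed (d : List (Strand E)) (hu : Fits [] u b) :
    Eqv d (b ++ d) (whiskerWord d u [] ++ passBlock d b) (whiskerWord [] u d) := by
  simpa using (Eqv.passBlock_word d hu).symm

/-! ### Virtual curls -/

namespace Eqv

/- Both curls are straightened by a zigzag, which turns them into the curl of the first
Reidemeister move. -/
theorem vcross_cap (x : Strand E) :
    Eqv [rev x, x] [] ([⟨[], .cross .virt (rev x) x, []⟩, ⟨[], .cap x, []⟩] : List (Slice V E))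
      [⟨[], .cap (rev x), []⟩] := by
  have hcap : Fits (V := V) [rev x, x] [⟨[], .cap (rev x), []⟩] [] := by simp
  have hcurl : Fits (V := V) [rev x, x]
      [⟨[], .cross .virt (rev x) x, []⟩, ⟨[], .cap x, []⟩] [] := by simp
  have uncurl : Eqv (V := V) [x] [x] [⟨[], .cup x, [x]⟩, ⟨[x], .cross .virt (rev x) x, []⟩,
      ⟨[x], .cap x, []⟩] [] := by
    trans [⟨[x], .cup x, []⟩, ⟨[], .cross .virt x x, [rev x]⟩, ⟨[x], .cap x, []⟩]
    · simpa using (slide_cup .virt x x).concat ⟨[x], .cap x, []⟩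
    · exact .of_rule (.inr (.curlRight .virt x))
  trans [⟨[rev x], .cup x, [x]⟩, ⟨[], .cap (rev x), [rev x, x]⟩,
      ⟨[], .cross .virt (rev x) x, []⟩, ⟨[], .cap x, []⟩]
  · simpa using (((zigzag_left (rev x)).whisker_right [x]).append_right hcurl).symm
  trans [⟨[rev x], .cup x, [x]⟩, ⟨[rev x, x], .cross .virt (rev x) x, []⟩,
      ⟨[rev x, x], .cap x, []⟩, ⟨[], .cap (rev x), []⟩]
  · simpa using (interchange hcap hcurl).cons ⟨[rev x], .cup x, [x]⟩
  · simpa using (uncurl.whisker_left [rev x]).append_right hcap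

theorem cup_vcross (x : Strand E) :
    Eqv [] [rev x, x] ([⟨[], .cup x, []⟩, ⟨[], .cross .virt x (rev x), []⟩] : List (Slice V E))
      [⟨[], .cup (rev x), []⟩] := by
  have hcup : Fits (V := V) [] [⟨[], .cup (rev x), []⟩] [rev x, x] := by simp
  have hcurl : Fits (V := V) [] [⟨[], .cup x, []⟩, ⟨[], .cross .virt x (rev x), []⟩]
      [rev x, x] := by simp
  have uncurl : Eqv (V := V) [x] [x] [⟨[x], .cup x, []⟩, ⟨[x], .cross .virt x (rev x), []⟩,
      ⟨[], .cap x, [x]⟩] [] := by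
    trans [⟨[x], .cup x, []⟩, ⟨[], .cross .virt x x, [rev x]⟩, ⟨[x], .cap x, []⟩]
    · simpa using (slide_cap .virt x x).cons ⟨[x], .cup x, []⟩
    · exact .of_rule (.inr (.curlRight .virt x))
  trans [⟨[], .cup x, []⟩, ⟨[], .cross .virt x (rev x), []⟩,
      ⟨[], .cup (rev x), [rev x, x]⟩, ⟨[rev x], .cap x, [x]⟩]
  · simpa using (((zigzag_right (rev x)).whisker_right [x]).append_left hcurl).symm
  trans [⟨[], .cup (rev x), []⟩, ⟨[rev x, x], .cup x, []⟩,
      ⟨[rev x, x], .cross .virt x (rev x), []⟩, ⟨[rev x], .cap x, [x]⟩]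
  · simpa using (interchange hcup hcurl).symm.concat ⟨[rev x], .cap x, [x]⟩
  · simpa using (uncurl.whisker_left [rev x]).append_left hcup

end Eqv

/-! ### Bending pieces -/

/-- Nested local minima, from `[]` to `(d.map rev).reverse ++ d`. -/
def cups : List (Strand E) → List (Slice V E)
  | [] => []
  | x :: d => cups d ++ [⟨(d.map rev).reverse, .cup (rev x), d⟩]

/-- Nested local maxima, from `d ++ (d.map rev).reverse` to `[]`. -/
def caps : List (Strand E) → List (Slice V E)
  | [] => []
  | x :: d => whiskerWord [x] (caps d) [rev x] ++ [⟨[], .cap x, []⟩]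

theorem fits_cups (d : List (Strand E)) :
    Fits [] (cups d : List (Slice V E)) ((d.map rev).reverse ++ d) := by
  induction d with
  | nil => simp [cups]
  | cons x d ih => exact ih.append (by simp)

theorem fits_caps (d : List (Strand E)) :
    Fits (d ++ (d.map rev).reverse) (caps d : List (Slice V E)) [] := by
  induction d with
  | nil => simp [caps]
  | cons x d ih => exact .append (by simpa using ih.whisker [x] [rev x]) (by simp)

theorem Eqv.snake (d : List (Strand E)) :
    Eqv d d (whiskerWord d (cups d : List (Slice V E)) [] ++ whiskerWord [] (caps d) d) [] := by
  induction d with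
  | nil => exact .refl (by simp [cups, caps])
  | cons x d ih =>
    have hcup : Fits (V := V) [] [⟨[], .cup (rev x), []⟩] [rev x, x] := by simp
    trans (whiskerWord (x :: d) (cups d) [] ++
        (whiskerWord [x] (caps d) d ++
        [⟨[x], .cup (rev x), d⟩, ⟨[], .cap x, x :: d⟩]))
    · have raise := ((interchange (fits_caps d) hcup).symm.whisker [x] d).append_right
        (show Fits _ [⟨[], .cap x, x :: d⟩] (x :: d) by simp)
      simpa [cups, caps] using
        append_left (by simpa using (fits_cups d).whisker_left (x :: d)) (by simpa using raise)
    trans [⟨[x], .cup (rev x), d⟩, ⟨[], .cap x, x :: d⟩]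
    · simpa using (ih.whisker_left [x]).append_right (by simp)
    · simpa using (zigzag_left x).whisker_right d

/-- The strands at the top of a piece after its bottom strands have been bent up to the left. -/
def Piece.ports (p : Piece V E) : List (Strand E) := (p.dom.map rev).reverse ++ p.cod

/-- The piece with its bottom strands bent up to the left. -/
def Piece.bent (p : Piece V E) : List (Slice V E) :=
  cups p.dom ++ [⟨(p.dom.map rev).reverse, p, []⟩]

theorem Piece.fits_bent (p : Piece V E) : Fits [] p.bent p.ports :=
  (fits_cups p.dom).append (by simp [Piece.ports])

theorem Eqv.bent_caps (p : Piece V E) :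
    Eqv p.dom p.cod (whiskerWord p.dom p.bent [] ++ whiskerWord [] (caps p.dom) p.cod)
      [⟨[], p, []⟩] := by
  trans (whiskerWord p.dom (cups p.dom) [] ++
      (whiskerWord [] (caps p.dom) p.dom ++ [⟨[], p, []⟩]))
  · have := (interchange (fits_caps p.dom) p.fits).symm.append_left
      (by simpa using (fits_cups p.dom).whisker_left p.dom)
    simpa [Piece.bent] using this
  · simpa using (snake p.dom).append_right p.fits

/-! ### Relabelling strands -/

section Map

/-- Relabel a strand, keeping its direction. -/
def mapStrand (g : E → F) (x : Strand E) : Strand F := (g x.1, x.2)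

@[simp] theorem mapStrand_rev (g : E → F) (x : Strand E) :
    mapStrand g (rev x) = rev (mapStrand g x) := rfl

/-- Relabel the strands of a piece. -/
def Piece.map (g : E → F) : Piece V E → Piece V F
  | cup x => cup (mapStrand g x)
  | cap x => cap (mapStrand g x)
  | cross t x y => cross t (mapStrand g x) (mapStrand g y)
  | vertex v below above => vertex v (below.map (mapStrand g)) (above.map (mapStrand g))

@[simp] theorem Piece.dom_map (g : E → F) (p : Piece V E) :
    (p.map g).dom = p.dom.map (mapStrand g) := by
  cases p <;> simp [Piece.map]

@[simp] theorem Piece.cod_map (g : E → F) (p : Piece V E) :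
    (p.map g).cod = p.cod.map (mapStrand g) := by
  cases p <;> simp [Piece.map]

/-- Relabel the strands of a slice. -/
def Slice.map (g : E → F) (s : Slice V E) : Slice V F :=
  ⟨s.left.map (mapStrand g), s.piece.map g, s.right.map (mapStrand g)⟩

/-- Relabel the strands of a word. -/
abbrev mapWord (g : E → F) (w : List (Slice V E)) : List (Slice V F) := w.map (Slice.map g)

variable (g : E → F)

@[simp] theorem mapWord_whiskerWord (l r : List (Strand E)) (u : List (Slice V E)) :
    mapWord g (whiskerWord l u r) =
      whiskerWord (l.map (mapStrand g)) (mapWord g u) (r.map (mapStrand g)) := by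
  simp [whiskerWord, Slice.whisker, Slice.map, Function.comp_def]

theorem Fits.map (h : Fits a u b) :
    Fits (a.map (mapStrand g)) (mapWord g u) (b.map (mapStrand g)) := by
  induction u generalizing a with
  | nil => simpa using congrArg _ h
  | cons s u ih =>
    obtain ⟨rfl, hu⟩ := h
    exact ⟨by simp [Slice.dom, Slice.map], by simpa [Slice.cod, Slice.map] using ih hu⟩

@[simp] theorem mapWord_passRight (t : CrossingType) (y : Strand E) (zs : List (Strand E)) :
    mapWord g (passRight t y zs : List (Slice V E)) =
      passRight t (mapStrand g y) (zs.map (mapStrand g)) := by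
  induction zs with
  | nil => rfl
  | cons z zs ih => simp [passRight_cons, Slice.map, Piece.map, ih]

@[simp] theorem mapWord_passBlock (d c : List (Strand E)) :
    mapWord g (passBlock d c : List (Slice V E)) =
      passBlock (d.map (mapStrand g)) (c.map (mapStrand g)) := by
  induction d with
  | nil => rfl
  | cons y d ih => simp [passBlock, ih]

@[simp] theorem mapWord_caps (d : List (Strand E)) :
    mapWord g (caps d : List (Slice V E)) = caps (d.map (mapStrand g)) := by
  induction d with
  | nil => rfl
  | cons y d ih => simp [caps, Slice.map, Piece.map, ih]

theorem PlanarRule.map {L R : List (Slice V E)} (h : PlanarRule L R) :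
    PlanarRule (mapWord g L) (mapWord g R) := by
  cases h with
  | interchange p q m =>
    simpa [Slice.map] using PlanarRule.interchange (p.map g) (q.map g) (m.map (mapStrand g))
  | zigzagLeft x => exact .zigzagLeft (mapStrand g x)
  | zigzagRight x => exact .zigzagRight (mapStrand g x)
  | slideCap t x y => exact .slideCap t (mapStrand g x) (mapStrand g y)
  | slideCup t x y => exact .slideCup t (mapStrand g x) (mapStrand g y)
  | bendLeft v below above x =>
    exact .bendLeft v (below.map (mapStrand g)) (above.map (mapStrand g)) (mapStrand g x)
  | bendRight v below above x =>
    simpa [Slice.map, Piece.map] using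
      PlanarRule.bendRight v (below.map (mapStrand g)) (above.map (mapStrand g)) (mapStrand g x)

theorem ReidemeisterRule.map {L R : List (Slice V E)} (h : ReidemeisterRule L R) :
    ReidemeisterRule (mapWord g L) (mapWord g R) := by
  cases h with
  | curlRight t x => exact .curlRight t (mapStrand g x)
  | curlLeft t x => exact .curlLeft t (mapStrand g x)
  | bigon t x y => exact .bigon t (mapStrand g x) (mapStrand g y)
  | triangle t₁ t₂ t₃ h x y z =>
    exact .triangle t₁ t₂ t₃ h (mapStrand g x) (mapStrand g y) (mapStrand g z)
  | pastVertex t y v below above =>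
    simpa [Slice.map, Piece.map] using ReidemeisterRule.pastVertex t (mapStrand g y) v
      (below.map (mapStrand g)) (above.map (mapStrand g))
  | twist t ht v below l r x y =>
    simpa [Slice.map, Piece.map] using ReidemeisterRule.twist t ht v (below.map (mapStrand g))
      (l.map (mapStrand g)) (r.map (mapStrand g)) (mapStrand g x) (mapStrand g y)

theorem Eqv.map (h : Eqv a b u v) :
    Eqv (a.map (mapStrand g)) (b.map (mapStrand g)) (mapWord g u) (mapWord g v) := by
  induction h with
  | refl h => exact .refl (h.map g)
  | step p q l r hr hL hR =>
    simpa using Eqv.step (mapWord g p) (mapWord g q) (l.map (mapStrand g)) (r.map (mapStrand g))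
      (hr.imp (PlanarRule.map g) (ReidemeisterRule.map g))
      (by simpa using hL.map g) (by simpa using hR.map g)
  | symm _ ih => exact ih.symm
  | trans _ _ ih₁ ih₂ => exact ih₁.trans ih₂

end Map

/-! ### Coherence of virtual words -/

/-- Local maxima and virtual crossings: the pieces that connect strands without leaving a trace in
the Gauss code. -/
inductive Piece.IsVirtual : Piece V E → Prop
  | cap (x : Strand E) : (Piece.cap x).IsVirtual
  | cross (x y : Strand E) : (Piece.cross .virt x y).IsVirtual

/-- A word of local maxima and virtual crossings. -/
def IsVirtual (u : List (Slice V E)) : Prop :=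
  ∀ s ∈ u, s.piece.IsVirtual

@[simp] theorem isVirtual_nil : IsVirtual ([] : List (Slice V E)) := by simp [IsVirtual]

@[simp] theorem isVirtual_cons {s : Slice V E} :
    IsVirtual (s :: u) ↔ s.piece.IsVirtual ∧ IsVirtual u := by
  simp [IsVirtual]

@[simp] theorem isVirtual_append : IsVirtual (u ++ v) ↔ IsVirtual u ∧ IsVirtual v := by
  simp only [IsVirtual, List.mem_append, or_imp, forall_and]

@[simp] theorem isVirtual_whiskerWord {l r : List (Strand E)} :
    IsVirtual (whiskerWord l u r) ↔ IsVirtual u := by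
  simp [IsVirtual, whiskerWord, Slice.whisker]

@[simp] theorem isVirtual_vpass (y : Strand E) (zs : List (Strand E)) :
    IsVirtual (vpass y zs : List (Slice V E)) := by
  induction zs with
  | nil => simp
  | cons z zs ih => simpa [passRight_cons] using ⟨.cross y z, ih⟩

@[simp] theorem isVirtual_passBlock (d c : List (Strand E)) :
    IsVirtual (passBlock d c : List (Slice V E)) := by
  induction d with
  | nil => simp [passBlock]
  | cons z zs ih => simpa [passBlock] using ih

@[simp] theorem isVirtual_caps (d : List (Strand E)) :
    IsVirtual (caps d : List (Slice V E)) := by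
  induction d with
  | nil => simp [caps]
  | cons z zs ih => simpa [caps] using ⟨ih, .cap z⟩

theorem IsVirtual.map (g : E → F) (h : IsVirtual u) : IsVirtual (mapWord g u) := by
  intro s hs
  obtain ⟨⟨l, p, r⟩, hp, rfl⟩ := List.mem_map.1 hs
  cases h _ hp with
  | cap x => exact .cap (mapStrand g x)
  | cross x y => exact .cross (mapStrand g x) (mapStrand g y)

/-- The strand `x` passes the strands `b` virtually and meets `rev x` in a local maximum. -/
def capOver (x : Strand E) (b : List (Strand E)) : List (Slice V E) :=
  whiskerWord [] (vpass x b) [rev x] ++ [⟨b, .cap x, []⟩]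

theorem fits_capOver (x : Strand E) (b : List (Strand E)) :
    Fits (x :: (b ++ [rev x])) (capOver x b : List (Slice V E)) b :=
  .append (by simpa using (fits_passRight .virt x b).whisker_right [rev x]) (by simp)

@[simp] theorem capOver_nil (x : Strand E) :
    (capOver x [] : List (Slice V E)) = [⟨[], .cap x, []⟩] := by
  simp [capOver]

theorem capOver_cons (x y : Strand E) (b : List (Strand E)) :
    (capOver x (y :: b) : List (Slice V E)) =
      ⟨[], .cross .virt x y, b ++ [rev x]⟩ :: whiskerWord [y] (capOver x b) [] := by
  simp [capOver, passRight_cons]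

namespace Eqv

theorem capOver_word (x : Strand E) (hu : Fits a u b) :
    Eqv (x :: (a ++ [rev x])) b (whiskerWord [x] u [rev x] ++ capOver x b) (capOver x a ++ u) := by
  trans (whiskerWord [] (vpass x a) [rev x] ++ (whiskerWord [] u [x, rev x] ++ [⟨b, .cap x, []⟩]))
  · simpa [capOver] using ((vpass_word x hu).symm.whisker_right [rev x]).append_right
      (show Fits _ [⟨b, .cap x, []⟩] b by simp)
  · have := (interchange hu (Piece.cap x).fits).append_left
      (by simpa using (fits_passRight .virt x a).whisker_right [rev x])
    simpa [capOver] using this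

theorem vcross_capOver (x y : Strand E) (b : List (Strand E)) :
    Eqv (y :: x :: (b ++ [rev x])) (y :: b)
      (⟨[], .cross .virt y x, b ++ [rev x]⟩ :: capOver x (y :: b) : List (Slice V E))
      (whiskerWord [y] (capOver x b) []) := by
  simpa [capOver_cons] using ((bigon .virt y x).whisker_right (b ++ [rev x])).append_right
    (by simpa using (fits_capOver x b).whisker_left [y])

theorem capOver_concat (x y : Strand E) (b : List (Strand E)) :
    Eqv (x :: (b ++ [y, rev x])) (b ++ [y]) (capOver x (b ++ [y]) : List (Slice V E))
      (⟨x :: b, .cross .virt y (rev x), []⟩ :: whiskerWord [] (capOver x b) [y]) := by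
  trans (whiskerWord [] (vpass x b) [y, rev x] ++
      [⟨b ++ [x], .cross .virt y (rev x), []⟩, ⟨b, .cap x, [y]⟩])
  · have := ((slide_cap (V := V) .virt x y).symm.whisker_left b).append_left
      (by simpa using (fits_passRight .virt x b).whisker_right [y, rev x])
    simpa [capOver, passRight_append, passRight_cons] using this
  · simpa [capOver] using
      (interchange (fits_passRight .virt x b) (Piece.cross .virt y (rev x)).fits).append_right
        (show Fits _ [⟨b, .cap x, [y]⟩] (b ++ [y]) by simp)

theorem vcross_capOver_concat (x y : Strand E) (b : List (Strand E)) :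
    Eqv (x :: (b ++ [rev x, y])) (b ++ [y])
      (⟨x :: b, .cross .virt (rev x) y, []⟩ :: capOver x (b ++ [y]) : List (Slice V E))
      (whiskerWord [] (capOver x b) [y]) := by
  trans (⟨x :: b, .cross .virt (rev x) y, []⟩ :: ⟨x :: b, .cross .virt y (rev x), []⟩ ::
      whiskerWord [] (capOver x b) [y])
  · simpa using (capOver_concat x y b).append_left
      (show Fits _ [⟨x :: b, .cross .virt (rev x) y, []⟩] _ by simp)
  · simpa using ((bigon .virt (rev x) y).whisker_left (x :: b)).append_right
      (by simpa using (fits_capOver x b).whisker_right [y])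

end Eqv

/-- The slice `s` can be moved from below to above the strand that starts at `x` and ends at
`rev x`, between the strands `L`, `B` and `C`. The strand may change its ends on the way, and the
word `w` that remains of `s` may be empty. -/
def Slice.MovesAbove (s : Slice V E) (L : List (Strand E)) (x : Strand E)
    (B C : List (Strand E)) : Prop :=
  ∃ L' x' B' C', s.cod = L' ++ x' :: (B' ++ rev x' :: C') ∧
    ∃ w, IsVirtual w ∧ Fits (L ++ (B ++ C)) w (L' ++ (B' ++ C')) ∧
      Eqv (L ++ x :: (B ++ rev x :: C)) (L' ++ (B' ++ C'))
        (s :: whiskerWord L' (capOver x' B') C') (whiskerWord L (capOver x B) C ++ w)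

namespace Piece

theorem IsVirtual.movesAbove_left {p : Piece V E} (hp : p.IsVirtual) (x : Strand E)
    (l L B C : List (Strand E)) :
    Slice.MovesAbove ⟨l, p, L ++ x :: (B ++ rev x :: C)⟩ (l ++ (p.dom ++ L)) x B C := by
  refine ⟨l ++ (p.cod ++ L), x, B, C, by simp, [⟨l, p, L ++ (B ++ C)⟩], by simpa, by simp, ?_⟩
  simpa using Eqv.interchange (p.fits.whisker l L) ((fits_capOver x B).whisker_right C)

theorem IsVirtual.movesAbove_inside {p : Piece V E} (hp : p.IsVirtual) (x : Strand E)
    (L B₁ B₂ C : List (Strand E)) :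
    Slice.MovesAbove ⟨L ++ x :: B₁, p, B₂ ++ rev x :: C⟩ L x (B₁ ++ (p.dom ++ B₂)) C := by
  refine ⟨L, x, B₁ ++ (p.cod ++ B₂), C, by simp, [⟨L ++ B₁, p, B₂ ++ C⟩], by simpa, by simp, ?_⟩
  simpa using (Eqv.capOver_word x (p.fits.whisker B₁ B₂)).whisker L C

theorem IsVirtual.movesAbove_right {p : Piece V E} (hp : p.IsVirtual) (x : Strand E)
    (L B C r : List (Strand E)) :
    Slice.MovesAbove ⟨L ++ x :: (B ++ rev x :: C), p, r⟩ L x B (C ++ (p.dom ++ r)) := by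
  refine ⟨L, x, B, C ++ (p.cod ++ r), by simp, [⟨L ++ (B ++ C), p, r⟩], by simpa, by simp, ?_⟩
  simpa using (Eqv.interchange ((fits_capOver x B).whisker_left L) (p.fits.whisker C r)).symm

end Piece

namespace Slice

theorem movesAbove_cross_start (x y : Strand E) (L B C : List (Strand E)) :
    MovesAbove (⟨L, .cross .virt y x, B ++ rev x :: C⟩ : Slice V E) (L ++ [y]) x B C := by
  refine ⟨L, x, y :: B, C, by simp, [], by simp, by simp, ?_⟩
  simpa using (Eqv.vcross_capOver x y B).whisker L C

theorem movesAbove_start_cross (x y : Strand E) (L B C : List (Strand E)) :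
    MovesAbove (⟨L, .cross .virt x y, B ++ rev x :: C⟩ : Slice V E) L x (y :: B) C := by
  refine ⟨L ++ [y], x, B, C, by simp, [], by simp, by simp, ?_⟩
  have := Eqv.refl ((fits_capOver (V := V) x (y :: B)).whisker L C)
  simpa [capOver_cons] using this

theorem movesAbove_cross_self (x : Strand E) (L C : List (Strand E)) :
    MovesAbove (⟨L, .cross .virt x (rev x), C⟩ : Slice V E) L x [] C := by
  refine ⟨L, rev x, [], C, by simp, [], by simp, by simp, ?_⟩
  simpa using (Eqv.vcross_cap (rev x)).whisker L C

theorem movesAbove_cross_end (x y : Strand E) (L B C : List (Strand E)) :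
    MovesAbove (⟨L ++ x :: B, .cross .virt y (rev x), C⟩ : Slice V E) L x (B ++ [y]) C := by
  refine ⟨L, x, B, y :: C, by simp, [], by simp, by simp, ?_⟩
  simpa using (Eqv.capOver_concat x y B).symm.whisker L C

theorem movesAbove_end_cross (x y : Strand E) (L B C : List (Strand E)) :
    MovesAbove (⟨L ++ x :: B, .cross .virt (rev x) y, C⟩ : Slice V E) L x B (y :: C) := by
  refine ⟨L, x, B ++ [y], C, by simp, [], by simp, by simp, ?_⟩
  simpa using (Eqv.vcross_capOver_concat x y B).whisker L C

end Slice

theorem adjacent_pair_cases {α : Type*} {l r L R : List α} {u v x : α}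
    (h : l ++ u :: v :: r = L ++ x :: R) :
    (∃ L₂, L = l ++ u :: v :: L₂ ∧ r = L₂ ++ x :: R) ∨
    (L = l ++ [u] ∧ v = x ∧ r = R) ∨
    (l = L ∧ u = x ∧ v :: r = R) ∨
    (∃ l₂, l = L ++ x :: l₂ ∧ R = l₂ ++ u :: v :: r) := by
  rcases List.append_eq_append_iff.1 h with ⟨m, hL, hm⟩ | ⟨m, hl, hm⟩
  · rcases m with _ | ⟨m₁, _ | ⟨m₂, m⟩⟩ <;> simp_all
  · rcases m with _ | ⟨m₁, m⟩ <;> simp_all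

theorem Piece.IsVirtual.eq_cap_or_movesAbove {l r L B C : List (Strand E)} {p : Piece V E}
    {x : Strand E} (hp : p.IsVirtual)
    (hdom : (⟨l, p, r⟩ : Slice V E).dom = L ++ x :: (B ++ rev x :: C))
    (hnd : (L ++ x :: (B ++ rev x :: C)).Nodup) :
    (l = L ∧ p = .cap x ∧ B = [] ∧ r = C) ∨ Slice.MovesAbove ⟨l, p, r⟩ L x B C := by
  obtain ⟨y, z, hyz⟩ : ∃ y z, p.dom = [y, z] := by cases hp <;> simp
  have hcap : p = .cap y ∧ z = rev y ∨ p = .cross .virt y z := by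
    cases hp <;> grind [Piece.dom_cap, Piece.dom_cross]
  have hpair : l ++ y :: z :: r = L ++ x :: (B ++ rev x :: C) := by simpa [hyz] using hdom
  rcases adjacent_pair_cases hpair with ⟨L₂, rfl, rfl⟩ | ⟨rfl, rfl, rfl⟩ | ⟨rfl, rfl, hB⟩ |
    ⟨B₁, rfl, hB⟩
  · exact .inr (by simpa [hyz] using hp.movesAbove_left x l L₂ B C)
  · obtain ⟨rfl, rfl⟩ | rfl := hcap
    · simp [List.nodup_append] at hnd
    · exact .inr (Slice.movesAbove_cross_start _ _ _ _ _)
  · rcases B with _ | ⟨y', B⟩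
    · obtain ⟨rfl, rfl⟩ : z = rev y ∧ r = C := by simpa using hB
      obtain ⟨rfl, -⟩ | rfl := hcap
      · simp
      · exact .inr (Slice.movesAbove_cross_self _ _ _)
    · obtain ⟨rfl, rfl⟩ : z = y' ∧ r = B ++ rev y :: C := by simpa using hB
      obtain ⟨rfl, rfl⟩ | rfl := hcap
      · simp [List.nodup_append] at hnd
      · exact .inr (Slice.movesAbove_start_cross _ _ _ _ _)
  rcases adjacent_pair_cases hB.symm with ⟨B₂, rfl, rfl⟩ | ⟨rfl, rfl, rfl⟩ | ⟨rfl, rfl, rfl⟩ |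
    ⟨C₁, rfl, rfl⟩
  · exact .inr (by simpa [hyz] using hp.movesAbove_inside x L B₁ B₂ C)
  · obtain ⟨rfl, hyx⟩ | rfl := hcap
    · obtain rfl : x = y := by simpa using congrArg rev hyx
      simp [List.nodup_append] at hnd
    · exact .inr (Slice.movesAbove_cross_end _ _ _ _ _)
  · obtain ⟨rfl, rfl⟩ | rfl := hcap
    · simp [List.nodup_append] at hnd
    · exact .inr (Slice.movesAbove_end_cross _ _ _ _ _)
  · exact .inr (by simpa [hyz] using hp.movesAbove_right x L B C₁ r)

theorem Piece.IsVirtual.nodup_cod {s : Slice V E} (hs : s.piece.IsVirtual)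
    (hd : s.dom.Nodup) : s.cod.Nodup := by
  obtain ⟨l, p, r⟩ := s
  cases hs with
  | cap x => exact hd.sublist (by simp)
  | cross x y => exact ((((List.Perm.swap x y []).append_left l).append_right r).nodup_iff).2 hd

namespace IsVirtual

theorem exists_capOver (hu : IsVirtual u) {L B C : List (Strand E)} {x : Strand E}
    (hfit : Fits (L ++ x :: (B ++ rev x :: C)) u [])
    (hnd : (L ++ x :: (B ++ rev x :: C)).Nodup) :
    ∃ u', IsVirtual u' ∧ Fits (L ++ (B ++ C)) u' [] ∧
      Eqv (L ++ x :: (B ++ rev x :: C)) [] u (whiskerWord L (capOver x B) C ++ u') := by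
  induction u generalizing L B C x with
  | nil => simp at hfit
  | cons s u ih =>
    obtain ⟨hs, hu'⟩ := isVirtual_cons.1 hu
    obtain ⟨hdom, hfit⟩ := hfit
    obtain ⟨rfl, hp, rfl, rfl⟩ | ⟨L', x', B', C', hcod, w, hw, hfw, hmove⟩ :=
      hs.eq_cap_or_movesAbove hdom hnd
    · obtain ⟨l, p, r⟩ := s
      obtain rfl : p = .cap x := hp
      refine ⟨u, hu', by simpa using hfit, ?_⟩
      simpa using Eqv.refl (show Fits (l ++ x :: rev x :: r) (⟨l, .cap x, r⟩ :: u) [] from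
        ⟨by simp, hfit⟩)
    · obtain ⟨u₂, hu₂, hfu₂, hpull⟩ :=
        ih hu' (hcod ▸ hfit) (hcod ▸ hs.nodup_cod (hdom ▸ hnd))
      refine ⟨w ++ u₂, by simp [hw, hu₂], hfw.append hfu₂, ?_⟩
      trans (s :: whiskerWord L' (capOver x' B') C' ++ u₂)
      · simpa [hdom, hcod] using Eqv.cons s (hcod ▸ hpull)
      · simpa using hmove.append_right hfu₂

theorem rev_mem (hu : IsVirtual u) (hfit : Fits a u []) {x : Strand E} (hx : x ∈ a) :
    rev x ∈ a := by
  induction u generalizing a with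
  | nil => simp_all
  | cons s u ih =>
    obtain ⟨hs, hu⟩ := isVirtual_cons.1 hu
    obtain ⟨rfl, hfit⟩ := hfit
    have hcod := ih hu hfit
    obtain ⟨l, p, r⟩ := s
    cases hs <;>
      simp only [Slice.dom_mk, Slice.cod_mk, Piece.dom_cap, Piece.cod_cap, Piece.dom_cross,
        Piece.cod_cross, List.mem_append, List.mem_cons, List.not_mem_nil, or_false,
        false_or] at hx hcod ⊢ <;>
      grind [rev_rev]

theorem eq_nil_of_fits_nil (hu : IsVirtual u) (hfit : Fits [] u b) : u = [] := by
  rcases u with _ | ⟨⟨l, p, r⟩, u⟩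
  · rfl
  · obtain ⟨hp, -⟩ := isVirtual_cons.1 hu
    cases hp <;> simp at hfit

theorem eqv (hu : IsVirtual u) (hv : IsVirtual v) (hnd : a.Nodup) (hfu : Fits a u [])
    (hfv : Fits a v []) : Eqv a [] u v := by
  induction h : a.length using Nat.strong_induction_on generalizing a u v with
  | _ n ih =>
  rcases a with _ | ⟨x, a⟩
  · rw [hu.eq_nil_of_fits_nil hfu, hv.eq_nil_of_fits_nil hfv]
    exact .refl (by simp)
  · have hx : rev x ∈ a := by simpa [rev_ne] using hu.rev_mem hfu List.mem_cons_self
    obtain ⟨B, C, rfl⟩ := List.append_of_mem hx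
    obtain ⟨u', hu', hfu', hu_pull⟩ := hu.exists_capOver (L := []) hfu hnd
    obtain ⟨v', hv', hfv', hv_pull⟩ := hv.exists_capOver (L := []) hfv hnd
    have hnd' : (B ++ C).Nodup :=
      hnd.sublist (((List.sublist_cons_self (rev x) C).append_left B).cons x)
    refine hu_pull.trans (.trans ?_ hv_pull.symm)
    exact (ih (B ++ C).length (by simp [← h]) hu' hv' hnd' hfu' hfv' rfl).append_left
      (by simpa using (fits_capOver x B).whisker_right C)

end IsVirtual

/-! ### Nodes -/

/-- The pieces of a diagram at which strands end or change their label: vertices, classical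
crossings, and local minima. -/
inductive Kind (V : Type*)
  | vert (v : V)
  | crs (t : CrossingType)
  | cup

/-- A node drawn with all its strands at the top. -/
def Kind.word : Kind V → List (Strand E) → List (Slice V E)
  | vert v, os => [⟨[], .vertex v [] os, []⟩]
  | crs t, [a, b, c, d] => [⟨[], .cup a, []⟩, ⟨[a], .cup b, [c]⟩, ⟨[a, b], .cross t d c, []⟩]
  | cup, [a, _] => [⟨[], .cup a, []⟩]
  | _, _ => []

/-- The strands that can leave a node of the given kind. -/
def Kind.Admits : Kind V → List (Strand E) → Prop
  | vert _, _ => True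
  | crs t, os => t ≠ .virt ∧ ∃ x y, os = [rev y, rev x, y, x]
  | cup, os => ∃ x, os = [x, rev x]

theorem Kind.Admits.fits {k : Kind V} {os : List (Strand E)} (h : k.Admits os) :
    Fits [] (k.word os) os := by
  cases k with
  | vert v => simp [Kind.word]
  | crs t =>
    obtain ⟨-, x, y, rfl⟩ := h
    simp [Kind.word]
  | cup =>
    obtain ⟨x, rfl⟩ := h
    simp [Kind.word]

/-- The kind of a piece, if it is a node. -/
inductive Piece.HasKind : Piece V E → Kind V → Prop
  | vertex (v : V) (below above : List (Strand E)) : HasKind (.vertex v below above) (.vert v)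
  | cross (t : CrossingType) (x y : Strand E) (ht : t ≠ .virt) : HasKind (.cross t x y) (.crs t)
  | cup (x : Strand E) : HasKind (.cup x) .cup

namespace Eqv

theorem bent_vertex (v : V) (below above : List (Strand E)) :
    Eqv [] (Piece.vertex v below above).ports (Piece.vertex v below above).bent
      [⟨[], .vertex v [] (Piece.vertex v below above).ports, []⟩] := by
  induction below generalizing above with
  | nil => exact .refl (Piece.fits_bent _)
  | cons z zs ih =>
    trans (cups zs ++ [⟨(zs.map rev).reverse, .vertex v zs (rev z :: above), []⟩])
    · have bend := Eqv.of_rule (a := zs) (b := rev z :: above)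
        (.inl (.bendLeft v zs above (rev z)))
      simpa [Piece.bent, Piece.ports, cups] using
        (bend.symm.whisker_left (zs.map rev).reverse).append_left (by simpa using fits_cups zs)
    · simpa [Piece.bent, Piece.ports] using ih (rev z :: above)

/-- The leftmost strand at the top of a vertex is moved to the right by bending it down, sliding it
under the vertex and bending it up again, so no virtual twist at the vertex is needed. -/
theorem rotate_vertex (v : V) (z : Strand E) (zs : List (Strand E)) :
    Eqv [] (zs ++ [z]) (⟨[], .vertex v [] (z :: zs), []⟩ :: vpass z zs)
      [⟨[], .vertex v [] (zs ++ [z]), []⟩] := by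
  have bendLeft : Eqv [] (z :: zs) [⟨[], .vertex v [] (z :: zs), []⟩]
      [⟨[], .cup z, []⟩, ⟨[z], .vertex v [rev z] zs, []⟩] := .of_rule (.inl (.bendLeft v [] zs z))
  have bendRight : Eqv [] (zs ++ [z]) [⟨[], .vertex v [] (zs ++ [z]), []⟩]
      [⟨[], .cup (rev z), []⟩, ⟨[], .vertex v [rev z] zs, [z]⟩] :=
    .of_rule (.inl (.bendRight v [] zs z))
  trans (⟨[], .cup z, []⟩ :: ⟨[z], .vertex v [rev z] zs, []⟩ :: vpass z zs)
  · simpa using bendLeft.append_right (fits_passRight .virt z zs)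
  trans [⟨[], .cup z, []⟩, ⟨[], .cross .virt z (rev z), []⟩, ⟨[], .vertex v [rev z] zs, [z]⟩]
  · simpa [passRight_cons] using
      (vpass_piece z (.vertex v [rev z] zs)).symm.append_left (Piece.cup z).fits
  trans [⟨[], .cup (rev z), []⟩, ⟨[], .vertex v [rev z] zs, [z]⟩]
  · simpa using (cup_vcross z).append_right (Piece.fits (.vertex v [rev z] zs) |>.whisker_right [z])
  · exact bendRight.symm

theorem rotate_crossing (t : CrossingType) (x y : Strand E) :
    Eqv [] [rev x, y, x, rev y]
      ((Kind.crs t : Kind V).word [rev y, rev x, y, x] ++ vpass (rev y) [rev x, y, x])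
      ((Kind.crs t.flip : Kind V).word [rev x, y, x, rev y]) := by
  have hcross : Fits (V := V) [y] [⟨[], .cup (rev x), [y]⟩, ⟨[rev x], .cross t x y, []⟩]
      [rev x, y, x] := by simp
  trans [⟨[], .cup (rev y), []⟩, ⟨[], .cross .virt (rev y) y, []⟩, ⟨[], .cup (rev x), [y, rev y]⟩,
      ⟨[rev x], .cross t x y, [rev y]⟩]
  · simpa [Kind.word, passRight_cons] using
      (vpass_word (rev y) hcross).symm.append_left
        (show Fits [] [⟨[], .cup (rev y), []⟩] _ by simp)
  trans [⟨[], .cup y, []⟩, ⟨[], .cup (rev x), [y, rev y]⟩, ⟨[rev x], .cross t x y, [rev y]⟩]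
  · simpa using (cup_vcross (rev y)).append_right (by simp)
  trans [⟨[], .cup (rev x), []⟩, ⟨[rev x, x], .cup y, []⟩, ⟨[rev x], .cross t x y, [rev y]⟩]
  · simpa using (interchange_piece (.cup (rev x)) (.cup y) []).symm.append_right
      (show Fits (V := V) _ [⟨[rev x], .cross t x y, [rev y]⟩] [rev x, y, x, rev y] by simp)
  · simpa [Kind.word] using ((slide_cup t.flip y x).symm.whisker_left [rev x]).append_left
      (show Fits [] [⟨[], .cup (rev x), []⟩] _ by simp)

end Eqv

namespace Piece.HasKind

variable {p : Piece V E} {k : Kind V}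

theorem admits (h : p.HasKind k) : k.Admits p.ports := by
  cases h with
  | vertex v below above => trivial
  | cross t x y ht => exact ⟨ht, x, y, by simp [Piece.ports]⟩
  | cup x => exact ⟨x, by simp [Piece.ports]⟩

theorem eqv (h : p.HasKind k) : Eqv [] p.ports p.bent (k.word p.ports) := by
  cases h with
  | vertex v below above => exact .bent_vertex v below above
  | cross t x y ht =>
    simpa [Piece.bent, Piece.ports, cups, Kind.word] using Eqv.refl (Piece.fits_bent (.cross t x y))
  | cup x => exact .refl (Piece.fits_bent (.cup x))

end Piece.HasKind

/-! ### Normal forms -/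

/-- A node with the name `idx` and labelled strands. -/
structure Node (V E : Type*) where
  idx : ℕ
  kind : Kind V
  outs : List (Strand (E × ℕ))

/-- Forget the numerical part of a label. -/
abbrev proj (x : Strand (E × ℕ)) : Strand E := mapStrand Prod.fst x

/-- All strands leaving the nodes of a list. -/
def ports (ns : List (Node V E)) : List (Strand (E × ℕ)) := ns.flatMap Node.outs

@[simp] theorem ports_nil : ports ([] : List (Node V E)) = [] := rfl

@[simp] theorem ports_cons (n : Node V E) (ns : List (Node V E)) :
    ports (n :: ns) = n.outs ++ ports ns := rfl

@[simp] theorem ports_append (ns ms : List (Node V E)) :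
    ports (ns ++ ms) = ports ns ++ ports ms := by
  simp [ports]

/-- The strands of the node can leave a node of its kind. -/
def Node.Admissible (n : Node V E) : Prop := n.kind.Admits (n.outs.map proj)

/-- The nodes of a list drawn side by side. -/
def nodesWord : List (Node V E) → List (Slice V E)
  | [] => []
  | n :: ns => n.kind.word (n.outs.map proj) ++ whiskerWord (n.outs.map proj) (nodesWord ns) []

section NormalForm

variable {ns ms ks ns' ms' : List (Node V E)}

theorem fits_nodesWord (h : ∀ n ∈ ns, n.Admissible) :
    Fits [] (nodesWord ns) ((ports ns).map proj) := by
  induction ns with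
  | nil => simp [nodesWord]
  | cons n ns ih =>
    obtain ⟨hn, hns⟩ := List.forall_mem_cons.1 h
    simpa [nodesWord] using (Kind.Admits.fits hn).append
      (by simpa using (ih hns).whisker_left (n.outs.map proj))

theorem nodesWord_append (ns ms : List (Node V E)) :
    nodesWord (ns ++ ms) = nodesWord ns ++ whiskerWord ((ports ns).map proj) (nodesWord ms) [] := by
  induction ns with
  | nil => simp [nodesWord]
  | cons n ns ih => simp [nodesWord, ih]

/-- The picture `w` is obtained from the nodes `ns` by connecting equal labels by virtual
strands. -/
def NormalForm (ns : List (Node V E)) (w : List (Slice V E)) : Prop :=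
  ∃ M : List (Slice V (E × ℕ)), IsVirtual M ∧ Fits (ports ns) M [] ∧
    Eqv [] [] w (nodesWord ns ++ mapWord Prod.fst M)

theorem NormalForm.eqv {w w' : List (Slice V E)} (hnd : (ports ns).Nodup) (hw : NormalForm ns w)
    (hw' : NormalForm ns w') (hns : ∀ n ∈ ns, n.Admissible) : Eqv [] [] w w' := by
  obtain ⟨M, hM, hfit, heqv⟩ := hw
  obtain ⟨M', hM', hfit', heqv'⟩ := hw'
  refine heqv.trans (.trans ?_ heqv'.symm)
  exact ((hM.eqv hM' hnd hfit hfit').map Prod.fst).append_left (fits_nodesWord hns)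

/-- The nodes `ns` can be drawn as the nodes `ms` followed by virtual crossings. -/
def Converts (ns ms : List (Node V E)) : Prop :=
  ∃ P : List (Slice V (E × ℕ)), IsVirtual P ∧ Fits (ports ms) P (ports ns) ∧
    Eqv [] ((ports ns).map proj) (nodesWord ns) (nodesWord ms ++ mapWord Prod.fst P)

theorem NormalForm.converts {w : List (Slice V E)} (hw : NormalForm ns w) (h : Converts ns ms) :
    NormalForm ms w := by
  obtain ⟨M, hM, hfit, heqv⟩ := hw
  obtain ⟨P, hP, hfitP, heqvP⟩ := h
  refine ⟨P ++ M, by simp [hP, hM], hfitP.append hfit, heqv.trans ?_⟩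
  simpa using heqvP.append_right (hfit.map Prod.fst)

namespace Converts

theorem refl (h : ∀ n ∈ ns, n.Admissible) : Converts ns ns :=
  ⟨[], by simp, by simp, by simpa using Eqv.refl (fits_nodesWord h)⟩

theorem trans (h : Converts ns ms) (h' : Converts ms ks) : Converts ns ks := by
  obtain ⟨P, hP, hfitP, heqvP⟩ := h
  obtain ⟨Q, hQ, hfitQ, heqvQ⟩ := h'
  refine ⟨Q ++ P, by simp [hP, hQ], hfitQ.append hfitP, heqvP.trans ?_⟩
  simpa using heqvQ.append_right (hfitP.map Prod.fst)

theorem append (h : Converts ns ms) (h' : Converts ns' ms') (hms : ∀ n ∈ ms, n.Admissible)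
    (hms' : ∀ n ∈ ms', n.Admissible) : Converts (ns ++ ns') (ms ++ ms') := by
  obtain ⟨P, hP, hfitP, heqvP⟩ := h
  obtain ⟨Q, hQ, hfitQ, heqvQ⟩ := h'
  refine ⟨whiskerWord [] P (ports ms') ++ whiskerWord (ports ns) Q [], by simp [hP, hQ], ?_, ?_⟩
  · simpa using (hfitP.whisker_right (ports ms')).append (hfitQ.whisker_left (ports ns))
  trans (nodesWord ms ++ (mapWord Prod.fst P ++
      (whiskerWord ((ports ns).map proj) (nodesWord ms') [] ++
        whiskerWord ((ports ns).map proj) (mapWord Prod.fst Q) [])))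
  · simpa [nodesWord_append] using
      heqvP.append (by simpa using heqvQ.whisker_left ((ports ns).map proj))
  · have hswap := ((Eqv.interchange (hfitP.map Prod.fst) (fits_nodesWord hms')).append_right
      ((hfitQ.map Prod.fst).whisker_left ((ports ns).map proj))).append_left
      (by simpa using fits_nodesWord hms)
    simpa [nodesWord_append] using hswap

theorem swap {n m : Node V E} (hn : n.Admissible) (hm : m.Admissible) :
    Converts [n, m] [m, n] := by
  refine ⟨passBlock m.outs n.outs, by simp, by simpa using fits_passBlock m.outs n.outs, ?_⟩
  trans (m.kind.word (m.outs.map proj) ++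
    whiskerWord [] (n.kind.word (n.outs.map proj)) (m.outs.map proj))
  · simpa [nodesWord] using Eqv.interchange hn.fits hm.fits
  · simpa [nodesWord] using
      ((Eqv.passBlock_closed (m.outs.map proj) hn.fits).append_left hm.fits).symm

theorem of_perm (h : ns.Perm ms) (hns : ∀ n ∈ ns, n.Admissible) : Converts ns ms := by
  induction h with
  | nil => exact .refl hns
  | @cons n ns ms hp ih =>
    obtain ⟨hn, hns⟩ := List.forall_mem_cons.1 hns
    have hn' : ∀ m ∈ [n], m.Admissible := by simpa using hn
    exact (Converts.refl hn').append (ih hns) hn' fun m hm => hns m (hp.mem_iff.2 hm)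
  | swap n m ns =>
    obtain ⟨hm, hn, hns⟩ : m.Admissible ∧ n.Admissible ∧ ∀ k ∈ ns, k.Admissible := by
      simpa using hns
    exact (Converts.swap hm hn).append (.refl hns) (by simp [hm, hn]) hns
  | trans hp _ ih₁ ih₂ => exact (ih₁ hns).trans (ih₂ fun m hm => hns m (hp.mem_iff.2 hm))

theorem of_forall₂ (h : List.Forall₂ (fun n m => Converts [n] [m] ∧ m.Admissible) ns ms) :
    Converts ns ms := by
  induction h with
  | nil => exact .refl (by simp)
  | @cons n m ns ms hnm h ih =>
    refine hnm.1.append ih (by simpa using hnm.2) fun k hk => ?_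
    obtain ⟨i, hi, rfl⟩ := List.getElem_of_mem hk
    exact (h.get (by simpa [h.length_eq] using hi) hi).2

theorem rotate_vertex {k k' : ℕ} (v : V) (z : Strand (E × ℕ)) (zs : List (Strand (E × ℕ))) :
    Converts [(⟨k, .vert v, zs ++ [z]⟩ : Node V E)] [⟨k', .vert v, z :: zs⟩] := by
  refine ⟨vpass z zs, by simp, by simpa using fits_passRight .virt z zs, ?_⟩
  simpa [nodesWord, Kind.word] using (Eqv.rotate_vertex v (proj z) (zs.map proj)).symm

theorem rotate_crossing {k k' : ℕ} {t : CrossingType} {a b c d : Strand (E × ℕ)}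
    (h : (⟨k, .crs t, [a, b, c, d]⟩ : Node V E).Admissible) :
    Converts [(⟨k', .crs t.flip, [b, c, d, a]⟩ : Node V E)] [⟨k, .crs t, [a, b, c, d]⟩] := by
  refine ⟨vpass a [b, c, d], by simp, by simpa using fits_passRight .virt a [b, c, d], ?_⟩
  obtain ⟨-, x, y, hproj⟩ := h
  obtain ⟨ha, hb, hc, hd⟩ : proj a = rev y ∧ proj b = rev x ∧ proj c = y ∧ proj d = x := by
    simpa using hproj
  simpa [nodesWord, ha, hb, hc, hd] using (Eqv.rotate_crossing (V := V) t x y).symm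

end Converts

end NormalForm

/-! ### Labelling the strands of a word -/

/-- `PieceLift k p d c o`: the strands of the `k`-th piece `p` are labelled by `d` at the bottom
and `c` at the top, labels change only at nodes, and `o` is the corresponding labelled node. -/
inductive PieceLift (k : ℕ) : Piece V E → List (Strand (E × ℕ)) → List (Strand (E × ℕ)) →
    Option (Node V E) → Prop
  | cap (x) : PieceLift k (.cap (proj x)) [x, rev x] [] none
  | virt (x y) : PieceLift k (.cross .virt (proj x) (proj y)) [x, y] [y, x] none
  | node {p κ d c} : p.HasKind κ → d.map proj = p.dom → c.map proj = p.cod →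
      PieceLift k p d c (some ⟨k, κ, (d.map rev).reverse ++ c⟩)

/-- `SliceLift k s b t o`: the strands of the `k`-th slice `s` are labelled by `b` at the bottom and
by `t` at the top, and `o` is the labelled node in it. -/
inductive SliceLift (k : ℕ) : Slice V E → List (Strand (E × ℕ)) → List (Strand (E × ℕ)) →
    Option (Node V E) → Prop
  | mk {l r p d c o} : PieceLift k p d c o →
      SliceLift k ⟨l.map proj, p, r.map proj⟩ (l ++ (d ++ r)) (l ++ (c ++ r)) o

/-- `Lift k b w ns`: the strands of the word `w`, whose slices are numbered from `k` on, are
labelled consistently; `b` are the labelled strands at the bottom and `ns` the labelled nodes. -/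
inductive Lift : ℕ → List (Strand (E × ℕ)) → List (Slice V E) → List (Node V E) → Prop
  | nil (k) : Lift k [] [] []
  | cons {k s b t o w ns} : SliceLift k s b t o → Lift (k + 1) t w ns →
      Lift k b (s :: w) (o.toList ++ ns)

theorem exists_fresh (a : List (Strand E)) {c : List (Strand (E × ℕ))} (hc : c.Nodup) :
    ∃ d : List (Strand (E × ℕ)), d.map proj = a ∧ (d ++ d.map rev ++ c).Nodup := by
  classical
  induction a with
  | nil => exact ⟨[], rfl, by simpa using hc⟩
  | cons x a ih =>
    obtain ⟨d, hd, hnd⟩ := ih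
    obtain ⟨N, hN⟩ := Infinite.exists_notMem_finset
      ((d ++ d.map rev ++ c).map fun y => y.1.2).toFinset
    have hfresh : ∀ y ∈ d ++ d.map rev ++ c, y.1.2 ≠ N := by
      simpa only [List.mem_toFinset, List.mem_map, not_exists, not_and] using hN
    have hz : ∀ s : Bool, ((x.1, N), s) ∉ d ++ d.map rev ++ c := fun s hs => hfresh _ hs rfl
    refine ⟨((x.1, N), x.2) :: d, by simp [hd, mapStrand], ?_⟩
    have hperm : (((x.1, N), x.2) :: d ++ (((x.1, N), x.2) :: d).map rev ++ c).Perm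
        (((x.1, N), x.2) :: ((x.1, N), !x.2) :: (d ++ d.map rev ++ c)) := by
      simp [rev, List.perm_middle]
    rw [hperm.nodup_iff, List.nodup_cons, List.nodup_cons, List.mem_cons, not_or]
    exact ⟨⟨by simp, hz _⟩, hz _, hnd⟩

namespace PieceLift

variable {k : ℕ} {p : Piece V E} {d c : List (Strand (E × ℕ))} {o : Option (Node V E)}

theorem map_dom (h : PieceLift k p d c o) : d.map proj = p.dom := by
  cases h with
  | cap | virt => simp
  | node _ hd _ => exact hd

theorem map_cod (h : PieceLift k p d c o) : c.map proj = p.cod := by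
  cases h with
  | cap | virt => simp
  | node _ _ hc => exact hc

theorem admissible {n : Node V E} (h : PieceLift k p d c (some n)) : n.Admissible := by
  cases h with
  | node hκ hd hc =>
    simpa [Node.Admissible, Piece.ports, ← hd, ← hc, Function.comp_def] using hκ.admits

theorem exists_of_hasKind {κ : Kind V} (hκ : p.HasKind κ) (hc : c.map proj = p.cod)
    {a : List (Strand (E × ℕ))} (hnd : (c ++ a).Nodup) (k : ℕ) :
    ∃ d o, PieceLift k p d c o ∧ (d ++ ports o.toList ++ a).Nodup := by
  obtain ⟨d, hd, hfresh⟩ := exists_fresh p.dom hnd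
  refine ⟨d, _, .node hκ hd hc, (List.Perm.nodup_iff ?_).2 hfresh⟩
  simpa using ((List.reverse_perm _).append_right (c ++ a)).append_left d

theorem exists_of_cod (hc : c.map proj = p.cod) {a : List (Strand (E × ℕ))}
    (hnd : (c ++ a).Nodup) (k : ℕ) :
    ∃ d o, PieceLift k p d c o ∧ (d ++ ports o.toList ++ a).Nodup := by
  cases p with
  | cup x => exact exists_of_hasKind (.cup x) hc hnd k
  | vertex v below above => exact exists_of_hasKind (.vertex v below above) hc hnd k
  | cap x =>
    obtain rfl : c = [] := by simpa using hc
    obtain ⟨d, hd, hfresh⟩ := exists_fresh [x] hnd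
    obtain ⟨x', rfl, rfl⟩ : ∃ x', d = [x'] ∧ proj x' = x := by simpa using hd
    exact ⟨_, _, .cap x', by simpa using hfresh⟩
  | cross t x y =>
    by_cases ht : t = .virt
    · obtain ⟨x', y', rfl, rfl, rfl⟩ : ∃ x' y', c = [y', x'] ∧ proj x' = x ∧ proj y' = y := by
        obtain ⟨y', _, rfl, rfl, hc⟩ := List.map_eq_cons_iff.1 hc
        obtain ⟨x', rfl, rfl⟩ : ∃ x', _ = [x'] ∧ proj x' = x := by simpa using hc
        exact ⟨x', y', rfl, rfl, rfl⟩
      subst ht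
      exact ⟨_, _, .virt x' y', (List.Perm.nodup_iff (.swap _ _ _)).1 (by simpa using hnd)⟩
    · exact exists_of_hasKind (.cross t x y ht) hc hnd k

end PieceLift

theorem Lift.exists_of_fits (h : Fits b w []) (k : ℕ) :
    ∃ b' ns, b'.map proj = b ∧ Lift k b' w ns ∧ (b' ++ ports ns).Nodup := by
  induction w generalizing b k with
  | nil => exact ⟨[], [], by simpa using h.symm, .nil k, by simp⟩
  | cons s w ih =>
    obtain ⟨rfl, h⟩ := h
    obtain ⟨b', ns, hb', hl, hnd⟩ := ih h (k + 1)
    obtain ⟨l, p, r⟩ := s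
    obtain ⟨l, b₁, rfl, rfl, hb₁⟩ := List.map_eq_append_iff.1 (by simpa using hb')
    obtain ⟨c, r, rfl, hc, rfl⟩ := List.map_eq_append_iff.1 hb₁
    have hperm (d m : List (Strand (E × ℕ))) :
        (l ++ (d ++ r) ++ (m ++ ports ns)).Perm (d ++ m ++ (l ++ (r ++ ports ns))) := by
      classical
      rw [List.perm_iff_count]
      intro x
      simp only [List.count_append]
      omega
    obtain ⟨d, o, hp, hnd'⟩ := PieceLift.exists_of_cod (a := l ++ (r ++ ports ns)) hc
      (by simpa using (hperm c []).nodup_iff.1 hnd) k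
    exact ⟨_, _, by simp [hp.map_dom], .cons (.mk hp) hl,
      by simpa using (hperm d (ports o.toList)).nodup_iff.2 hnd'⟩

theorem Lift.admissible {k : ℕ} {b : List (Strand (E × ℕ))} {ns : List (Node V E)}
    (h : Lift k b w ns) : ∀ n ∈ ns, n.Admissible := by
  induction h with
  | nil => simp
  | cons hs _ ih =>
    obtain ⟨hp⟩ := hs
    intro n hn
    rcases List.mem_append.1 hn with hn | hn
    · obtain rfl : _ = some n := by simpa using hn
      exact hp.admissible
    · exact ih n hn

/-! ### Pulling the nodes out of a word -/

/-- The node is drawn to the right of all strands, its strands are led virtually to the place where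
the piece was and are connected to the strands below it. -/
theorem Eqv.slice_node {p : Piece V E} {κ : Kind V} (h : p.HasKind κ) (l r : List (Strand E)) :
    Eqv (l ++ (p.dom ++ r)) (l ++ (p.cod ++ r))
      (whiskerWord (l ++ (p.dom ++ r)) (κ.word p.ports) [] ++
        (whiskerWord (l ++ p.dom) (passBlock r p.ports) [] ++
          whiskerWord l (caps p.dom) (p.cod ++ r)))
      [⟨l, p, r⟩] := by
  have hcaps : Fits (l ++ (p.dom ++ (p.ports ++ r)))
      (whiskerWord l (caps p.dom : List (Slice V E)) (p.cod ++ r)) (l ++ (p.cod ++ r)) := by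
    simpa [Piece.ports] using (fits_caps (V := V) p.dom).whisker l (p.cod ++ r)
  trans (whiskerWord (l ++ p.dom) (κ.word p.ports) r ++ whiskerWord l (caps p.dom) (p.cod ++ r))
  · simpa using ((passBlock_closed r h.admits.fits).whisker_left (l ++ p.dom)).append_right
      (by simpa using hcaps)
  trans (whiskerWord (l ++ p.dom) p.bent r ++ whiskerWord l (caps p.dom) (p.cod ++ r))
  · simpa using (h.eqv.symm.whisker (l ++ p.dom) r).append_right (by simpa using hcaps)
  · simpa using (bent_caps p).whisker l r

section NormalForm

variable {k : ℕ} {b c d : List (Strand (E × ℕ))} {p : Piece V E} {o : Option (Node V E)}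
  {ns : List (Node V E)}

theorem PieceLift.exists_virtual (h : PieceLift k p d c o) (l r : List (Strand (E × ℕ))) :
    ∃ Q : List (Slice V (E × ℕ)), IsVirtual Q ∧
      Fits (l ++ (d ++ (r ++ ports o.toList))) Q (l ++ (c ++ r)) ∧
      Eqv ((l ++ (d ++ r)).map proj) ((l ++ (c ++ r)).map proj) [⟨l.map proj, p, r.map proj⟩]
        (whiskerWord ((l ++ (d ++ r)).map proj) (nodesWord o.toList) [] ++
          mapWord Prod.fst Q) := by
  cases h with
  | cap x =>
    refine ⟨[⟨l, .cap x, r⟩], by simpa using .cap x, by simp, ?_⟩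
    simpa [nodesWord, Slice.map, Piece.map] using
      Eqv.refl (V := V) ((Piece.cap (proj x)).fits.whisker (l.map proj) (r.map proj))
  | virt x y =>
    refine ⟨[⟨l, .cross .virt x y, r⟩], by simpa using .cross x y, by simp, ?_⟩
    simpa [nodesWord, Slice.map, Piece.map] using
      Eqv.refl (V := V) ((Piece.cross .virt (proj x) (proj y)).fits.whisker (l.map proj)
        (r.map proj))
  | @node _ κ _ _ hκ hd hc =>
    obtain ⟨outs, houts⟩ : ∃ outs, outs = (d.map rev).reverse ++ c := ⟨_, rfl⟩
    have hports : outs.map proj = p.ports := by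
      simp [houts, Piece.ports, ← hd, ← hc, Function.comp_def]
    rw [← houts]
    refine ⟨whiskerWord (l ++ d) (passBlock r outs) [] ++ whiskerWord l (caps d) (c ++ r),
      by simp, .append (b := l ++ (d ++ (outs ++ r))) ?_ ?_, ?_⟩
    · simpa using (fits_passBlock (V := V) r outs).whisker_left (l ++ d)
    · simpa [houts] using (fits_caps (V := V) d).whisker l (c ++ r)
    · simpa [nodesWord, hports, hd, hc] using
        (Eqv.slice_node hκ (l.map proj) (r.map proj)).symm

theorem Lift.exists_virtual (h : Lift k b w ns) :
    ∃ M : List (Slice V (E × ℕ)), IsVirtual M ∧ Fits (b ++ ports ns) M [] ∧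
      Eqv (b.map proj) [] w
        (whiskerWord (b.map proj) (nodesWord ns) [] ++ mapWord Prod.fst M) := by
  induction h with
  | nil => exact ⟨[], by simp, by simp, .refl (by simp)⟩
  | @cons k s b t o w ns hs hl ih =>
    obtain @⟨l, r, p, d, c, _, hp⟩ := hs
    obtain ⟨M, hM, hfitM, heqvM⟩ := ih
    obtain ⟨Q, hQ, hfitQ, heqvQ⟩ := hp.exists_virtual l r
    refine ⟨whiskerWord [] Q (ports ns) ++ M, by simp [hQ, hM],
      .append (by simpa using hfitQ.whisker_right (ports ns)) (by simpa using hfitM), ?_⟩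
    have hns : Fits ((l ++ (c ++ r)).map proj) (whiskerWord ((l ++ (c ++ r)).map proj)
        (nodesWord ns) [] ++ mapWord Prod.fst M) [] := by
      refine .append (b := (l ++ (c ++ r) ++ ports ns).map proj) ?_
        (by simpa using hfitM.map Prod.fst)
      simpa using (fits_nodesWord hl.admissible).whisker_left ((l ++ (c ++ r)).map proj)
    have ho : Fits [] (nodesWord o.toList) ((ports o.toList).map proj) :=
      fits_nodesWord (by simpa using fun n hn => PieceLift.admissible (hn ▸ hp))
    trans (⟨l.map proj, p, r.map proj⟩ :: (whiskerWord ((l ++ (c ++ r)).map proj)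
      (nodesWord ns) [] ++ mapWord Prod.fst M))
    · exact heqvM.append_left (show Fits ((l ++ (d ++ r)).map proj)
        [⟨l.map proj, p, r.map proj⟩] _ by simp [hp.map_dom, hp.map_cod])
    trans (whiskerWord ((l ++ (d ++ r)).map proj) (nodesWord o.toList) [] ++ mapWord Prod.fst Q ++
      (whiskerWord ((l ++ (c ++ r)).map proj) (nodesWord ns) [] ++ mapWord Prod.fst M))
    · exact heqvQ.append_right hns
    · have hswap := Eqv.interchange (hfitQ.map Prod.fst) (fits_nodesWord hl.admissible)
      simpa [nodesWord_append] using (hswap.append_right (v := mapWord Prod.fst M) (c := [])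
        (by simpa using hfitM.map Prod.fst)).append_left
          (by simpa using ho.whisker_left ((l ++ (d ++ r)).map proj))

theorem Lift.normalForm (h : Lift k [] w ns) : NormalForm ns w := by
  simpa [NormalForm] using h.exists_virtual

end NormalForm

/-! ### Following labels through nodes -/

/-- `Pass n x y m`: a strand that arrives at the end `x` of the node `n` continues at the end `y`;
`m` is the letter recorded at a classical crossing.  The ends `a, b, c, d` of a crossing are listed
clockwise from the bottom right one. -/
inductive Pass : Node V E → Strand (E × ℕ) → Strand (E × ℕ) → Option Letter → Prop
  | cup_left {k a b} : Pass ⟨k, .cup, [a, b]⟩ a b none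
  | cup_right {k a b} : Pass ⟨k, .cup, [a, b]⟩ b a none
  | cross_bd {k t a b c d} : Pass ⟨k, .crs t, [a, b, c, d]⟩ b d
      (some ⟨k, t == .upper, (t == .upper) == (d.2 == c.2)⟩)
  | cross_db {k t a b c d} : Pass ⟨k, .crs t, [a, b, c, d]⟩ d b
      (some ⟨k, t == .upper, (t == .upper) == (d.2 == c.2)⟩)
  | cross_ac {k t a b c d} : Pass ⟨k, .crs t, [a, b, c, d]⟩ a c
      (some ⟨k, !(t == .upper), (t == .upper) == (d.2 == c.2)⟩)
  | cross_ca {k t a b c d} : Pass ⟨k, .crs t, [a, b, c, d]⟩ c a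
      (some ⟨k, !(t == .upper), (t == .upper) == (d.2 == c.2)⟩)

/-- The strand leaving a node at the end `x`, followed through the nodes `ns`, ends at a vertex and
meets the crossings `l`. -/
inductive NodeTrace (ns : List (Node V E)) : Strand (E × ℕ) → List Letter → Prop
  | finish {n v x} : n ∈ ns → n.kind = .vert v → rev x ∈ n.outs → NodeTrace ns x []
  | pass {n x y m l} : n ∈ ns → Pass n (rev x) y m → NodeTrace ns y l →
      NodeTrace ns x (m.toList ++ l)

/-- A strand with the label `x` entering a slice with the node `o` leaves it with the label `y`,
having met the letter `m`. -/
def Crosses (o : Option (Node V E)) (x y : Strand (E × ℕ)) (m : Option Letter) : Prop :=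
  (m = none ∧ y = x) ∨ ∃ n, o = some n ∧ Pass n (rev x) y m

theorem NodeTrace.of_crosses {ns : List (Node V E)} {o : Option (Node V E)}
    {x y : Strand (E × ℕ)} {m : Option Letter} {l : List Letter} (ho : ∀ n, o = some n → n ∈ ns)
    (hxy : Crosses o x y m) (h : NodeTrace ns y l) : NodeTrace ns x (m.toList ++ l) := by
  obtain ⟨rfl, rfl⟩ | ⟨n, rfl, hn⟩ := hxy
  · exact h
  · exact .pass (ho n rfl) hn h

/-- The label of a strand leaving a slice through the top (`true`) or the bottom (`false`), directed
along the way it is followed. -/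
def leaving (b : Bool) (x : Strand (E × ℕ)) : Strand (E × ℕ) := if b then x else rev x

@[simp] theorem leaving_true (x : Strand (E × ℕ)) : leaving true x = x := rfl

@[simp] theorem leaving_false (x : Strand (E × ℕ)) : leaving false x = rev x := rfl

theorem getElem?_pair_eq_some {α : Type*} {x y z : α} {i : ℕ} :
    [x, y][i]? = some z ↔ (i = 0 ∧ x = z) ∨ (i = 1 ∧ y = z) := by
  rcases i with _ | _ | i <;> simp

theorem map_eq_pair_iff {α β : Type*} {f : α → β} {l : List α} {y z : β} :
    l.map f = [y, z] ↔ ∃ a b, l = [a, b] ∧ f a = y ∧ f b = z := by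
  rcases l with _ | ⟨a, _ | ⟨b, _ | ⟨c, l⟩⟩⟩ <;> simp

namespace PieceLift

variable {k : ℕ} {p : Piece V E} {d c : List (Strand (E × ℕ))} {o : Option (Node V E)}
  {b b' : Bool} {i j : ℕ} {m : Option Bool} {x : Strand (E × ℕ)}

theorem follow_none (h : PieceLift k p d c o) (hx : (if b then c else d)[i]? = some x)
    (hf : p.follow b i = none) :
    ∃ n v, o = some n ∧ n.kind = .vert v ∧ rev (leaving (!b) x) ∈ n.outs := by
  cases h with
  | cap | virt => simp [Piece.follow] at hf
  | node hκ hd hc =>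
    cases hκ with
    | cup | cross => simp [Piece.follow] at hf
    | vertex v below above =>
      refine ⟨_, v, rfl, rfl, ?_⟩
      have hmem := List.mem_of_getElem? hx
      cases b
      · exact List.mem_append_left _ (List.mem_reverse.2 (List.mem_map_of_mem hmem))
      · exact List.mem_append_right _ (by simpa using hmem)

theorem follow_cross {t : CrossingType} {z z' : Strand E} (ht : t ≠ .virt)
    (hd : d.map proj = [z, z']) (hc : c.map proj = [z', z])
    (hx : (if b then c else d)[i]? = some x)
    (hf : (Piece.cross t z z' : Piece V E).follow b i = some (b', j, m)) :
    ∃ y, (if b' then c else d)[j]? = some y ∧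
      Pass (V := V) ⟨k, .crs t, (d.map rev).reverse ++ c⟩ (rev (leaving (!b) x)) (leaving b' y)
        (m.map fun isOver => ⟨k, isOver, (Piece.cross t z z' : Piece V E).sign⟩) := by
  obtain ⟨d₀, d₁, rfl, -, -⟩ : ∃ d₀ d₁, d = [d₀, d₁] ∧ proj d₀ = z ∧ proj d₁ = z' :=
    map_eq_pair_iff.1 hd
  obtain ⟨c₀, c₁, rfl, hy, hy'⟩ : ∃ c₀ c₁, c = [c₀, c₁] ∧ proj c₀ = z' ∧ proj c₁ = z :=
    map_eq_pair_iff.1 hc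
  have hsign : (Piece.cross t z z' : Piece V E).sign = ((t == .upper) == (c₁.2 == c₀.2)) := by
    simp [Piece.sign, ← hy, ← hy', mapStrand]
  rw [hsign]
  simp only [Piece.follow, Option.some.injEq, Prod.mk.injEq] at hf
  obtain ⟨rfl, rfl, rfl⟩ := hf
  cases b <;> obtain ⟨rfl, rfl⟩ | ⟨rfl, rfl⟩ := getElem?_pair_eq_some.1 hx
  · exact ⟨c₁, rfl, by cases t <;> first | exact absurd rfl ht | exact .cross_bd⟩
  · exact ⟨c₀, rfl, by cases t <;> first | exact absurd rfl ht | exact .cross_ac⟩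
  · refine ⟨d₁, rfl, ?_⟩
    rw [Bool.not_true, leaving_false, rev_rev]
    cases t <;> first | exact absurd rfl ht | exact .cross_ca
  · refine ⟨d₀, rfl, ?_⟩
    rw [Bool.not_true, leaving_false, rev_rev]
    cases t <;> first | exact absurd rfl ht | exact .cross_db

theorem follow_some (h : PieceLift k p d c o) (hx : (if b then c else d)[i]? = some x)
    (hf : p.follow b i = some (b', j, m)) :
    ∃ y, (if b' then c else d)[j]? = some y ∧
      Crosses o (leaving (!b) x) (leaving b' y) (m.map fun isOver => ⟨k, isOver, p.sign⟩) := by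
  cases h with
  | cap z =>
    simp only [Piece.follow, Option.some.injEq, Prod.mk.injEq] at hf
    obtain ⟨rfl, rfl, rfl⟩ := hf
    cases b
    · obtain ⟨rfl, rfl⟩ | ⟨rfl, rfl⟩ := getElem?_pair_eq_some.1 hx <;> simp [Crosses]
    · simp at hx
  | virt z z' =>
    simp only [Piece.follow, Option.some.injEq, Prod.mk.injEq] at hf
    obtain ⟨rfl, rfl, rfl⟩ := hf
    cases b <;> obtain ⟨rfl, rfl⟩ | ⟨rfl, rfl⟩ := getElem?_pair_eq_some.1 hx <;> simp [Crosses]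
  | node hκ hd hc =>
    cases hκ with
    | cup z =>
      obtain rfl : d = [] := by simpa using hd
      obtain ⟨y, y', rfl, -, -⟩ : ∃ y y', c = [y, y'] ∧ proj y = z ∧ proj y' = rev z :=
        map_eq_pair_iff.1 hc
      simp only [Piece.follow, Option.some.injEq, Prod.mk.injEq] at hf
      obtain ⟨rfl, rfl, rfl⟩ := hf
      cases b
      · simp at hx
      · obtain ⟨rfl, rfl⟩ | ⟨rfl, rfl⟩ := getElem?_pair_eq_some.1 hx
        · exact ⟨y', rfl, .inr ⟨_, rfl, by simpa using Pass.cup_left⟩⟩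
        · exact ⟨y, rfl, .inr ⟨_, rfl, by simpa using Pass.cup_right⟩⟩
    | vertex => simp [Piece.follow] at hf
    | cross t z z' ht =>
      obtain ⟨y, hy, hpass⟩ := follow_cross ht hd hc hx hf
      exact ⟨y, hy, .inr ⟨_, rfl, hpass⟩⟩

theorem arity_eq (h : PieceLift k p d c o) (b : Bool) :
    p.arity b = (if b then c else d).length := by
  cases b <;> simp [Piece.arity, ← h.map_dom, ← h.map_cod]

end PieceLift

namespace SliceLift

variable {k : ℕ} {s : Slice V E} {bot top : List (Strand (E × ℕ))} {o : Option (Node V E)}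
  {b b' : Bool} {j j' : ℕ} {m : Option Bool} {x : Strand (E × ℕ)}

theorem follow_none (h : SliceLift k s bot top o) (hx : (if b then top else bot)[j]? = some x)
    (hf : s.follow b j = none) :
    ∃ n v, o = some n ∧ n.kind = .vert v ∧ rev (leaving (!b) x) ∈ n.outs := by
  obtain @⟨l, r, p, d, c, _, hp⟩ := h
  obtain ⟨q, hq⟩ : ∃ q : Bool → List (Strand (E × ℕ)), ∀ b, (if b then c else d) = q b :=
    ⟨_, fun _ => rfl⟩
  rw [← apply_ite (fun q => l ++ (q ++ r)), hq] at hx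
  simp only [Slice.follow, List.length_map, hp.arity_eq, hq] at hf
  split_ifs at hf with hleft hmid
  rw [List.getElem?_append_right (by omega), List.getElem?_append_left (by omega), ← hq] at hx
  exact hp.follow_none hx (by simpa using hf)

theorem follow_some (h : SliceLift k s bot top o) (hx : (if b then top else bot)[j]? = some x)
    (hf : s.follow b j = some (b', j', m)) :
    ∃ y, (if b' then top else bot)[j']? = some y ∧
      Crosses o (leaving (!b) x) (leaving b' y)
        (m.map fun isOver => ⟨k, isOver, s.piece.sign⟩) := by
  obtain @⟨l, r, p, d, c, _, hp⟩ := h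
  obtain ⟨q, hq⟩ : ∃ q : Bool → List (Strand (E × ℕ)), ∀ b, (if b then c else d) = q b :=
    ⟨_, fun _ => rfl⟩
  rw [← apply_ite (fun q => l ++ (q ++ r)), hq] at hx ⊢
  simp only [Slice.follow, List.length_map, hp.arity_eq, hq] at hf
  split_ifs at hf with hleft hmid
  · obtain ⟨rfl, rfl, rfl⟩ : (!b) = b' ∧ j = j' ∧ none = m := by simpa using hf
    rw [List.getElem?_append_left hleft] at hx
    exact ⟨x, by rw [List.getElem?_append_left hleft, hx], .inl ⟨rfl, rfl⟩⟩
  · simp only [Option.map_eq_some_iff, Prod.mk.injEq, Prod.exists] at hf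
    obtain ⟨b', i, m, hf, rfl, rfl, rfl⟩ := hf
    rw [List.getElem?_append_right (by omega), List.getElem?_append_left (by omega), ← hq] at hx
    obtain ⟨y, hy, hxy⟩ := hp.follow_some hx hf
    rw [hq] at hy
    have hi := (List.getElem?_eq_some_iff.1 hy).1
    refine ⟨y, ?_, hxy⟩
    rw [List.getElem?_append_right (by omega), List.getElem?_append_left (by omega)]
    simpa using hy
  · obtain ⟨rfl, rfl, rfl⟩ : (!b) = b' ∧ _ = j' ∧ none = m := by simpa using hf
    rw [List.getElem?_append_right (by omega), List.getElem?_append_right (by omega)] at hx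
    refine ⟨x, ?_, .inl ⟨rfl, rfl⟩⟩
    rw [List.getElem?_append_right (by omega), List.getElem?_append_right (by omega), ← hx]
    congr 1
    omega

end SliceLift

/-- The labels at all levels of a labelled word, and the labelled nodes of its slices. -/
structure Levels (k : ℕ) (w : List (Slice V E)) (ns : List (Node V E))
    (lev : ℕ → List (Strand (E × ℕ))) (o : ℕ → Option (Node V E)) : Prop where
  slice : ∀ i s, w[i]? = some s → SliceLift (k + i) s (lev i) (lev (i + 1)) (o i)
  mem : ∀ i n, o i = some n → n ∈ ns
  exists_of_mem : ∀ n ∈ ns, ∃ i s, w[i]? = some s ∧ o i = some n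

theorem Lift.exists_levels {k : ℕ} {b : List (Strand (E × ℕ))} {ns : List (Node V E)}
    (h : Lift k b w ns) : ∃ lev o, lev 0 = b ∧ Levels k w ns lev o := by
  induction h with
  | nil => exact ⟨fun _ => [], fun _ => none, rfl, by simp, by simp, by simp⟩
  | @cons k s b t o w ns hs _ ih =>
    obtain ⟨lev, os, rfl, hlev⟩ := ih
    refine ⟨fun i => i.casesOn b lev, fun i => i.casesOn o os, rfl, ?_, ?_, ?_⟩
    · rintro (_ | i) s' hs'
      · obtain rfl : s = s' := by simpa using hs'
        exact hs
      · simpa [Nat.add_right_comm, Nat.add_assoc] using hlev.slice i s' (by simpa using hs')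
    · rintro (_ | i) n hn
      · exact List.mem_append_left _ (by simpa using hn)
      · exact List.mem_append_right _ (hlev.mem i n hn)
    · intro n hn
      rcases List.mem_append.1 hn with hn | hn
      · exact ⟨0, s, rfl, by simpa using hn⟩
      · obtain ⟨i, s', hs', hi⟩ := hlev.exists_of_mem n hn
        exact ⟨i + 1, s', by simpa using hs', hi⟩

theorem Levels.nodeTrace {ns : List (Node V E)} {lev : ℕ → List (Strand (E × ℕ))}
    {o : ℕ → Option (Node V E)} (hlev : Levels 0 w ns lev o) (hbot : lev 0 = []) {k : ℕ} {b : Bool}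
    {j : ℕ} {l : List Letter} (h : Trace w k b j l) {x : Strand (E × ℕ)}
    (hx : (lev (if b then k + 1 else k))[j]? = some x) : NodeTrace ns (leaving b x) l := by
  have slice {i s} (hs : w[i]? = some s) : SliceLift i s (lev i) (lev (i + 1)) (o i) := by
    simpa using hlev.slice i s hs
  have enter {k : ℕ} {b : Bool} {j : ℕ} {x : Strand (E × ℕ)}
      (hx : (lev (if b then k + 1 else k))[j]? = some x) :
      (if !b then lev (nextIndex k b + 1) else lev (nextIndex k b))[j]? = some x := by
    cases b
    · rcases k with _ | k
      · simp [hbot] at hx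
      · simpa [nextIndex] using hx
    · simpa [nextIndex] using hx
  induction h generalizing x with
  | finish hs hf =>
    obtain ⟨n, v, hn, hv, hmem⟩ := (slice hs).follow_none (enter hx) hf
    exact .finish (hlev.mem _ n hn) hv (by simpa using hmem)
  | pass hs hf _ ih =>
    obtain ⟨y, hy, hxy⟩ := (slice hs).follow_some (enter hx) hf
    rw [← apply_ite lev] at hy
    simpa using (ih hy).of_crosses (hlev.mem _) hxy
  | meet hs hf _ ih =>
    obtain ⟨y, hy, hxy⟩ := (slice hs).follow_some (enter hx) hf
    rw [← apply_ite lev] at hy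
    simpa using (ih hy).of_crosses (hlev.mem _) hxy

section Nodes

variable {ns : List (Node V E)} {n n' : Node V E} {x y y' : Strand (E × ℕ)} {m m' : Option Letter}
  {l l' : List Letter}

theorem mem_ports : x ∈ ports ns ↔ ∃ n ∈ ns, x ∈ n.outs := by
  simp [ports]

theorem node_unique (hnd : (ports ns).Nodup) (hn : n ∈ ns) (hn' : n' ∈ ns) (hx : x ∈ n.outs)
    (hx' : x ∈ n'.outs) : n = n' := by
  by_contra hne
  have : Std.Symm (Function.onFun List.Disjoint (Node.outs (V := V) (E := E))) :=
    ⟨fun _ _ h => h.symm⟩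
  exact ((List.nodup_flatMap.1 hnd).2.forall hn hn' hne) hx hx'

theorem outs_nodup (hnd : (ports ns).Nodup) (hn : n ∈ ns) : n.outs.Nodup :=
  (List.nodup_flatMap.1 hnd).1 n hn

namespace Pass

theorem symm (h : Pass n x y m) : Pass n y x m := by
  cases h <;> constructor

theorem left_mem (h : Pass n x y m) : x ∈ n.outs := by
  cases h <;> simp

theorem right_mem (h : Pass n x y m) : y ∈ n.outs :=
  h.symm.left_mem

theorem kind_ne (h : Pass n x y m) (v : V) : n.kind ≠ .vert v := by
  cases h <;> simp

theorem unique (hnd : n.outs.Nodup) (h : Pass n x y m) (h' : Pass n x y' m') :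
    y = y' ∧ m = m' := by
  cases h <;> cases h' <;> simp_all

theorem proj_eq (hn : n.Admissible) (h : Pass n x y m) : proj y = rev (proj x) := by
  cases h with
  | cup_left | cup_right =>
    obtain ⟨z, hz⟩ := hn
    simp_all
  | _ =>
    obtain ⟨-, z, z', hz⟩ := hn
    simp_all

end Pass

namespace NodeTrace

theorem of_pass (hnd : (ports ns).Nodup) (h : NodeTrace ns x l) (hn : n ∈ ns)
    (hp : Pass n (rev x) y m) : ∃ l', l = m.toList ++ l' ∧ NodeTrace ns y l' := by
  cases h with
  | finish hn' hv hx =>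
    obtain rfl := node_unique hnd hn hn' hp.left_mem hx
    exact absurd hv (hp.kind_ne _)
  | pass hn' hp' h =>
    obtain rfl := node_unique hnd hn hn' hp.left_mem hp'.left_mem
    obtain ⟨rfl, rfl⟩ := hp.unique (outs_nodup hnd hn) hp'
    exact ⟨_, rfl, h⟩

theorem of_vert (hnd : (ports ns).Nodup) {v : V} (h : NodeTrace ns x l) (hn : n ∈ ns)
    (hv : n.kind = .vert v) (hx : rev x ∈ n.outs) : l = [] := by
  cases h with
  | finish => rfl
  | pass hn' hp' h =>
    obtain rfl := node_unique hnd hn hn' hx hp'.left_mem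
    exact absurd hv (hp'.kind_ne _)

theorem unique (hnd : (ports ns).Nodup) (h : NodeTrace ns x l) (h' : NodeTrace ns x l') :
    l = l' := by
  induction h generalizing l' with
  | finish hn hv hx => exact (h'.of_vert hnd hn hv hx).symm
  | pass hn hp _ ih =>
    obtain ⟨l'', rfl, h''⟩ := h'.of_pass hnd hn hp
    rw [ih h'']

theorem ne_of_circle (hnd : (ports ns).Nodup) {k : ℕ} {a : Strand (E × ℕ)}
    (hn : (⟨k, .cup, [rev a, a]⟩ : Node V E) ∈ ns) (h : NodeTrace ns x l) :
    ¬(x = a ∨ x = rev a) := by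
  have hmem (y : Strand (E × ℕ)) : y = a ∨ y = rev a → rev y ∈ [rev a, a] := by
    rintro (rfl | rfl) <;> simp
  intro hx
  induction h with
  | finish hn' hv hx' =>
    obtain rfl := node_unique hnd hn hn' (hmem _ hx) hx'
    simp at hv
  | pass hn' hp _ ih =>
    obtain rfl := node_unique hnd hn hn' (hmem _ hx) hp.left_mem
    exact ih (by simpa [or_comm] using hp.right_mem)

end NodeTrace

end Nodes

/-! ### Renaming nodes and labels -/

/-- Rename a node and the labels of its strands. -/
def Node.map (f : ℕ → ℕ) (h : E × ℕ → E × ℕ) (n : Node V E) : Node V E :=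
  ⟨f n.idx, n.kind, n.outs.map (mapStrand h)⟩

/-- Rename the crossing recorded by a letter. -/
def Letter.rename (f : ℕ → ℕ) (a : Letter) : Letter := { a with name := f a.name }

@[simp] theorem Letter.rename_id : Letter.rename id = id := rfl

/-- The vertices of a list of nodes, with the strands at them. -/
def vertexData (ns : List (Node V E)) : List (V × List (Strand E)) :=
  ns.filterMap fun n => match n.kind with
    | .vert v => some (v, n.outs.map proj)
    | _ => none

theorem vertexData_append (ns ms : List (Node V E)) :
    vertexData (ns ++ ms) = vertexData ns ++ vertexData ms := by
  simp [vertexData]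

section Map

variable {ns : List (Node V E)} {h : E × ℕ → E × ℕ}

theorem Pass.map {n : Node V E} {x y : Strand (E × ℕ)} {m : Option Letter} (hp : Pass n x y m)
    (f : ℕ → ℕ) (h : E × ℕ → E × ℕ) :
    Pass (n.map f h) (mapStrand h x) (mapStrand h y) (m.map (Letter.rename f)) := by
  cases hp with
  | cup_left => exact .cup_left
  | cup_right => exact .cup_right
  | cross_bd => exact .cross_bd
  | cross_db => exact .cross_db
  | cross_ac => exact .cross_ac
  | cross_ca => exact .cross_ca

theorem ports_map (ns : List (Node V E)) (f : ℕ → ℕ) (h : E × ℕ → E × ℕ) :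
    ports (ns.map (Node.map f h)) = (ports ns).map (mapStrand h) := by
  induction ns with
  | nil => rfl
  | cons n ns ih => simp [ih, Node.map]

theorem proj_mapStrand (hh : ∀ a, (h a).1 = a.1) (x : Strand (E × ℕ)) :
    proj (mapStrand h x) = proj x := by
  simp [mapStrand, hh]

theorem proj_comp_mapStrand (hh : ∀ a, (h a).1 = a.1) : proj ∘ mapStrand h = proj :=
  funext (proj_mapStrand hh)

theorem Node.Admissible.map {n : Node V E} (hn : n.Admissible) (f : ℕ → ℕ)
    (hh : ∀ a, (h a).1 = a.1) : (n.map f h).Admissible := by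
  simpa [Node.Admissible, Node.map, proj_comp_mapStrand hh] using hn

theorem nodesWord_map (ns : List (Node V E)) (f : ℕ → ℕ) (hh : ∀ a, (h a).1 = a.1) :
    nodesWord (ns.map (Node.map f h)) = nodesWord ns := by
  induction ns with
  | nil => rfl
  | cons n ns ih => simp [nodesWord, ih, Node.map, proj_comp_mapStrand hh]

theorem vertexData_map (ns : List (Node V E)) (f : ℕ → ℕ) (hh : ∀ a, (h a).1 = a.1) :
    vertexData (ns.map (Node.map f h)) = vertexData ns := by
  simp [vertexData, List.filterMap_map, Function.comp_def, Node.map, proj_mapStrand hh]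

theorem Piece.map_map {F' : Type*} (g : E → F) (g' : F → F') (p : Piece V E) :
    (p.map g).map g' = p.map (g' ∘ g) := by
  cases p <;> simp [Piece.map, mapStrand, Function.comp_def]

theorem mapWord_mapWord {F' : Type*} (g : E → F) (g' : F → F') (w : List (Slice V E)) :
    mapWord g' (mapWord g w) = mapWord (g' ∘ g) w := by
  simp [Slice.map, Piece.map_map, mapStrand, Function.comp_def]

theorem mapWord_fst_mapWord (hh : ∀ a, (h a).1 = a.1) (w : List (Slice V (E × ℕ))) :
    mapWord Prod.fst (mapWord h w) = mapWord Prod.fst w := by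
  rw [mapWord_mapWord, show (Prod.fst ∘ h : E × ℕ → E) = Prod.fst from funext hh]

theorem NormalForm.map (hw : NormalForm ns w) (f : ℕ → ℕ) (hh : ∀ a, (h a).1 = a.1) :
    NormalForm (ns.map (Node.map f h)) w := by
  obtain ⟨M, hM, hfit, heqv⟩ := hw
  refine ⟨mapWord h M, hM.map h, ?_, ?_⟩
  · rw [ports_map]
    exact hfit.map h
  · rwa [nodesWord_map _ _ hh, mapWord_fst_mapWord hh]

end Map

/-! ### Codes -/

/-- The labelled nodes `ns` describe a graph whose edges have the Gauss words `W`. -/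
structure IsCode (ns : List (Node V E)) (W : E → List Letter) : Prop where
  admissible : ∀ n ∈ ns, n.Admissible
  nodup : (ports ns).Nodup
  vert_inj : ∀ n ∈ ns, ∀ n' ∈ ns, ∀ v v', n.kind = .vert v → n'.kind = .vert v' →
    ∀ x ∈ n.outs, ∀ x' ∈ n'.outs, proj x = proj x' → x = x'
  start : ∀ e, ∃ n ∈ ns, ∃ v, n.kind = .vert v ∧ ∃ x ∈ n.outs, proj x = (e, true) ∧
    NodeTrace ns x (W e)
  total : ∀ x ∈ ports ns, x.2 = true → ∃ l, NodeTrace ns x l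

theorem IsCode.map {ns ms : List (Node V E)} {W : E → List Letter} (hc : IsCode ns W)
    {f : ℕ → ℕ} {h : E × ℕ → E × ℕ} (hh : ∀ a, (h a).1 = a.1) (hms : ∀ n ∈ ms, n ∈ ns)
    (hvert : ∀ n ∈ ns, ∀ v, n.kind = .vert v → n ∈ ms)
    (hnd : ((ports ms).map (mapStrand h)).Nodup)
    (htrace : ∀ x l, NodeTrace ns x l →
      NodeTrace (ms.map (Node.map f h)) (mapStrand h x) (l.map (Letter.rename f))) :
    IsCode (ms.map (Node.map f h)) fun e => (W e).map (Letter.rename f) where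
  admissible := by
    simpa only [List.forall_mem_map] using fun n hn => (hc.admissible n (hms n hn)).map f hh
  nodup := by rwa [ports_map]
  vert_inj := by
    simp only [List.forall_mem_map]
    intro n hn n' hn' v v' hv hv' x₁ hx₁ x₁' hx₁' hproj
    obtain ⟨x, hx, rfl⟩ := List.mem_map.1 hx₁
    obtain ⟨x', hx', rfl⟩ := List.mem_map.1 hx₁'
    rw [proj_mapStrand hh, proj_mapStrand hh] at hproj
    rw [hc.vert_inj n (hms n hn) n' (hms n' hn') v v' hv hv' x hx x' hx' hproj]
  start e := by
    obtain ⟨n, hn, v, hv, x, hx, hxe, hl⟩ := hc.start e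
    exact ⟨_, List.mem_map_of_mem (hvert n hn v hv), v, hv, _, List.mem_map_of_mem hx,
      by rw [proj_mapStrand hh, hxe], htrace x _ hl⟩
  total := by
    rw [ports_map]
    simp only [List.forall_mem_map]
    intro x hx hdir
    obtain ⟨n, hn, hx⟩ := mem_ports.1 hx
    obtain ⟨l, hl⟩ := hc.total x (mem_ports.2 ⟨n, hms n hn, hx⟩) hdir
    exact ⟨_, htrace x l hl⟩

/-! ### Removing local minima -/

@[simp] theorem mapWord_capOver (g : E → F) (z : Strand E) (c : List (Strand E)) :
    mapWord g (capOver z c : List (Slice V E)) = capOver (mapStrand g z) (c.map (mapStrand g)) := by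
  simp [capOver, Slice.map, Piece.map]

theorem Eqv.cup_capOver (z : Strand E) (c : List (Strand E)) :
    Eqv (z :: c) (c ++ [z])
      (⟨z :: c, .cup (rev z), []⟩ :: whiskerWord [] (capOver z c) [z] : List (Slice V E))
      (vpass z c) := by
  trans (vpass z c ++ [⟨c ++ [z], .cup (rev z), []⟩, ⟨c, .cap z, [z]⟩])
  · simpa [capOver] using (interchange (fits_passRight (V := V) .virt z c)
      (Piece.fits (.cup (rev z)))).symm.append_right
        (show Fits (V := V) _ [⟨c, .cap z, [z]⟩] (c ++ [z]) by simp)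
  · simpa using ((Eqv.zigzag_left (V := V) z).whisker c []).append_left
      (by simpa using fits_passRight (V := V) .virt z c)

section RemoveCup

variable {ns ms : List (Node V E)} {z y : Strand (E × ℕ)} {k : ℕ} {h : E × ℕ → E × ℕ}

/-- The strand labelled `rev z` runs virtually to the other end of the strand `z`, and the zigzag
obtained there is straightened, so that `z` continues as `y`. -/
theorem NormalForm.remove_cup (hw : NormalForm (ms ++ [⟨k, .cup, [rev z, y]⟩]) w) (hzy : z ≠ y)
    (hms : ∀ n ∈ ms, n.Admissible) (hnd : (ports (ms ++ [⟨k, .cup, [rev z, y]⟩])).Nodup)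
    (hglue : mapStrand h z = mapStrand h y) (hh : ∀ a, (h a).1 = a.1) :
    NormalForm (ms.map (Node.map id h)) w := by
  obtain ⟨M, hM, hfit, heqv⟩ := hw
  have hproj : proj y = proj z := by rw [← proj_mapStrand hh, ← hglue, proj_mapStrand hh]
  have hz : z ∈ ports ms := by
    simpa [hzy, (rev_ne z).symm] using hM.rev_mem hfit (x := rev z) (by simp)
  obtain ⟨B, C, hBC⟩ := List.append_of_mem hz
  simp only [ports_append, ports_cons, ports_nil, List.append_nil] at hfit hnd
  obtain ⟨M', hM', hfit', hpull⟩ := hM.exists_capOver (L := B) (x := z) (B := C) (C := [y])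
    (by simpa [hBC] using hfit) (by simpa [hBC] using hnd)
  refine ⟨mapWord h (whiskerWord B (vpass z C) [] ++ M'), IsVirtual.map h (by simp [hM']), ?_, ?_⟩
  · have hpass := ((fits_passRight (V := V) .virt z C).whisker_left B).map h
    have hrest := hfit'.map h
    rw [ports_map, hBC]
    simpa using Fits.append (by simpa [hglue] using hpass) (by simpa using hrest)
  rw [nodesWord_map _ _ hh, mapWord_fst_mapWord hh]
  have hnodes : Fits [] (nodesWord ms) (B.map proj ++ proj z :: C.map proj) := by
    simpa [hBC] using fits_nodesWord hms
  trans nodesWord ms ++ (⟨B.map proj ++ proj z :: C.map proj, .cup (rev (proj z)), []⟩ ::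
    whiskerWord (B.map proj) (capOver (proj z) (C.map proj)) [proj z] ++ mapWord Prod.fst M')
  · refine heqv.trans ?_
    have hfits : Fits (V := V) [] (nodesWord ms ++
        [⟨B.map proj ++ proj z :: C.map proj, .cup (rev (proj z)), []⟩])
        (B.map proj ++ proj z :: (C.map proj ++ [rev (proj z), proj z])) :=
      hnodes.append (by simp)
    have hclose := (hpull.map Prod.fst).append_left (by simpa [hproj] using hfits)
    simpa [nodesWord, nodesWord_append, Kind.word, hBC, hproj] using hclose
  · have hstraight := (Eqv.cup_capOver (V := V) (proj z) (C.map proj)).whisker_left (B.map proj)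
    have hrest := hfit'.map Prod.fst
    simpa using (hstraight.append_right (by simpa [hproj] using hrest)).append_left
      (by simpa using hnodes)

theorem NodeTrace.remove_cup {x : Strand (E × ℕ)} {l : List Letter} (hl : NodeTrace ns x l)
    (hns : ∀ n ∈ ns, n = ⟨k, .cup, [rev z, y]⟩ ∨ n ∈ ms)
    (hglue : mapStrand h z = mapStrand h y) :
    NodeTrace (ms.map (Node.map id h)) (mapStrand h x) l := by
  induction hl with
  | @finish n v x hn hv hx =>
    obtain rfl | hn := hns n hn
    · simp at hv
    · exact .finish (List.mem_map_of_mem hn) hv (List.mem_map_of_mem (f := mapStrand h) hx)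
  | @pass n x x' m l hn hp _ ih =>
    obtain rfl | hn := hns n hn
    · obtain ⟨rfl, hxx'⟩ : m = none ∧ mapStrand h x = mapStrand h x' := by
        generalize hx : rev x = rx at hp
        obtain rfl : x = rev rx := by rw [← hx, rev_rev]
        cases hp with
        | cup_left => simpa using hglue
        | cup_right => simpa using congrArg rev hglue.symm
      rwa [hxx']
    · simpa using NodeTrace.pass (List.mem_map_of_mem hn) (by simpa using hp.map id h) ih

theorem mapStrand_update [DecidableEq E] {x : Strand (E × ℕ)} (hdir : y.2 = z.2)
    (hx : x ≠ rev z) :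
    mapStrand (Function.update id z.1 y.1) x = if x = z then y else x := by
  obtain ⟨x, i⟩ := x
  obtain ⟨z, j⟩ := z
  obtain ⟨y, j'⟩ := y
  obtain rfl : j' = j := hdir
  rcases eq_or_ne x z with rfl | hxz
  · obtain rfl : i = j' := by simpa [rev] using hx
    simp [mapStrand]
  · simp [mapStrand, hxz]

theorem mapStrand_update_eq [DecidableEq E] (hdir : y.2 = z.2) :
    mapStrand (Function.update id z.1 y.1) z = mapStrand (Function.update id z.1 y.1) y := by
  have hy : y ≠ rev z := fun hy => by simp [hy, rev] at hdir
  rw [mapStrand_update hdir (rev_ne z).symm, mapStrand_update hdir hy, if_pos rfl, ite_self]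

theorem nodup_map_update [DecidableEq E] {l : List (Strand (E × ℕ))} (hl : l.Nodup)
    (hdir : y.2 = z.2) (hz : rev z ∉ l) (hy : y ∉ l) :
    (l.map (mapStrand (Function.update id z.1 y.1))).Nodup := by
  refine hl.map_on fun x hx x' hx' h => ?_
  rw [mapStrand_update hdir (ne_of_mem_of_not_mem hx hz),
    mapStrand_update hdir (ne_of_mem_of_not_mem hx' hz)] at h
  split_ifs at h <;> simp_all

end RemoveCup

section RemoveCups

variable {ns : List (Node V E)} {W : E → List Letter}

theorem IsCode.exists_cup (hc : IsCode ns W) {n : Node V E} (hn : n ∈ ns) (hk : n.kind = .cup) :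
    ∃ k z y, n = ⟨k, .cup, [rev z, y]⟩ ∧ z ≠ y ∧ proj y = proj z := by
  obtain ⟨k, κ, outs⟩ := n
  obtain rfl : κ = .cup := hk
  obtain ⟨x, hx⟩ : ∃ x, outs.map proj = [x, rev x] := hc.admissible _ hn
  obtain ⟨z, y, rfl, rfl, hy⟩ := map_eq_pair_iff.1 hx
  refine ⟨k, rev z, y, by simp, ?_, by simpa using hy⟩
  rintro rfl
  have hmem : z ∈ ports ns ∧ rev z ∈ ports ns :=
    ⟨mem_ports.2 ⟨_, hn, by simp⟩, mem_ports.2 ⟨_, hn, by simp⟩⟩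
  obtain ⟨x, hx, hxz, hdir⟩ : ∃ x ∈ ports ns, (x = rev z ∨ x = rev (rev z)) ∧ x.2 = true := by
    rcases hz : z.2
    · exact ⟨rev z, hmem.2, .inl rfl, by simp [rev, hz]⟩
    · exact ⟨z, hmem.1, .inr (rev_rev z).symm, hz⟩
  obtain ⟨l, hl⟩ := hc.total x hx hdir
  exact hl.ne_of_circle hc.nodup (by simpa using hn) hxz

theorem IsCode.remove_cup (hc : IsCode ns W) (hw : NormalForm ns w) {n : Node V E} (hn : n ∈ ns)
    (hk : n.kind = .cup) :
    ∃ ns', IsCode ns' W ∧ NormalForm ns' w ∧ ns'.length < ns.length ∧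
      vertexData ns' = vertexData ns ∧ (ns'.map Node.idx).Sublist (ns.map Node.idx) := by
  classical
  obtain ⟨k, z, y, rfl, hzy, hproj⟩ := hc.exists_cup hn hk
  obtain ⟨X, Y, rfl⟩ := List.append_of_mem hn
  set cup : Node V E := ⟨k, .cup, [rev z, y]⟩ with hcup
  set h : E × ℕ → E × ℕ := Function.update id z.1 y.1
  obtain ⟨hedge, hdir⟩ : y.1.1 = z.1.1 ∧ y.2 = z.2 := Prod.ext_iff.1 hproj
  have hh (c : E × ℕ) : (h c).1 = c.1 := by
    rcases eq_or_ne c z.1 with rfl | hc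
    · simpa [h] using hedge
    · simp [h, hc]
  have hglue : mapStrand h z = mapStrand h y := mapStrand_update_eq hdir
  have hmem {n : Node V E} : n ∈ X ++ cup :: Y ↔ n = cup ∨ n ∈ X ++ Y := by
    simp [or_left_comm]
  have hperm : (X ++ cup :: Y).Perm ((X ++ Y) ++ [cup]) :=
    List.perm_middle.trans (List.perm_append_singleton _ _).symm
  have hnd : (ports ((X ++ Y) ++ [cup])).Nodup :=
    (hperm.flatMap_right Node.outs).nodup_iff.1 hc.nodup
  have hms : ∀ n ∈ X ++ Y, n ∈ X ++ cup :: Y := fun n hn => hmem.2 (.inr hn)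
  obtain ⟨hndXY, -, hdisj⟩ := List.nodup_append'.1 (ports_append (X ++ Y) [cup] ▸ hnd)
  have hnd' : ((ports (X ++ Y)).map (mapStrand h)).Nodup :=
    nodup_map_update hndXY hdir (fun hz => hdisj hz (by simp [hcup]))
      (fun hy => hdisj hy (by simp [hcup]))
  refine ⟨(X ++ Y).map (Node.map id h), ?_, ?_, by simp, ?_, ?_⟩
  · have hvert (n : Node V E) (hn : n ∈ X ++ cup :: Y) (v : V) (hv : n.kind = .vert v) :
        n ∈ X ++ Y := by
      obtain rfl | hn := hmem.1 hn
      · simp [hcup] at hv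
      · exact hn
    have hcode := hc.map (f := id) hh hms hvert hnd' fun x l hl => by
      simpa using hl.remove_cup (fun n hn => hmem.1 hn) hglue
    simpa only [Letter.rename_id, List.map_id] using hcode
  · exact (hw.converts (.of_perm hperm hc.admissible)).remove_cup hzy
      (fun n hn => hc.admissible n (hms n hn)) hnd hglue hh
  · rw [vertexData_map _ _ hh, vertexData_append, vertexData_append]
    simp [vertexData, hcup]
  · simp [Function.comp_def, Node.map]

theorem IsCode.remove_cups (hc : IsCode ns W) (hw : NormalForm ns w) :
    ∃ ns', IsCode ns' W ∧ NormalForm ns' w ∧ (∀ n ∈ ns', n.kind ≠ .cup) ∧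
      vertexData ns' = vertexData ns ∧ (ns'.map Node.idx).Sublist (ns.map Node.idx) := by
  induction hlen : ns.length using Nat.strong_induction_on generalizing ns with
  | _ N ih =>
  by_cases h : ∃ n ∈ ns, n.kind = .cup
  · obtain ⟨n, hn, hk⟩ := h
    obtain ⟨ns₁, hc₁, hw₁, hlt, hvert₁, hidx₁⟩ := hc.remove_cup hw hn hk
    obtain ⟨ns', hc', hw', hcup, hvert, hidx⟩ := ih _ (hlen ▸ hlt) hc₁ hw₁ rfl
    exact ⟨ns', hc', hw', hcup, hvert.trans hvert₁, hidx.trans hidx₁⟩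
  · push Not at h
    exact ⟨ns, hc, hw, h, rfl, .refl _⟩

end RemoveCups

/-! ### The code of a diagram -/

theorem mem_vertexData {ns : List (Node V E)} {v : V} {os : List (Strand E)} :
    (v, os) ∈ vertexData ns ↔ ∃ n ∈ ns, n.kind = .vert v ∧ n.outs.map proj = os := by
  simp only [vertexData, List.mem_filterMap]
  refine exists_congr fun n => and_congr_right fun _ => ?_
  rcases n with ⟨k, _ | _ | _, outs⟩ <;> simp

theorem vert_unique {ns : List (Node V E)} (h : ((vertexData ns).map Prod.fst).Nodup)
    {n n' : Node V E} {v : V} (hn : n ∈ ns) (hn' : n' ∈ ns) (hv : n.kind = .vert v)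
    (hv' : n'.kind = .vert v) : n = n' := by
  have hpair : ns.Pairwise fun n n' => ∀ v, n.kind = .vert v → n'.kind ≠ .vert v :=
    (List.pairwise_filterMap.1 (List.pairwise_map.1 h)).imp fun {n n'} hne v hv hv' =>
      hne (v, n.outs.map proj) (by simp [hv]) (v, n'.outs.map proj) (by simp [hv']) rfl
  have : Std.Symm fun n n' : Node V E => ∀ v, n.kind = .vert v → n'.kind ≠ .vert v :=
    ⟨fun _ _ h v hv hv' => h v hv' hv⟩
  by_contra hne
  exact hpair.forall hn hn' hne v hv hv'

theorem SliceLift.exists_pieceLift {k : ℕ} {s : Slice V E} {bot top : List (Strand (E × ℕ))}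
    {o : Option (Node V E)} (h : SliceLift k s bot top o) :
    ∃ l r d c, s.left = l.map proj ∧ bot = l ++ (d ++ r) ∧ top = l ++ (c ++ r) ∧
      PieceLift k s.piece d c o := by
  obtain @⟨l, r, p, d, c, _, hp⟩ := h
  exact ⟨l, r, d, c, rfl, rfl, rfl, hp⟩

theorem SliceLift.map_cod {k : ℕ} {s : Slice V E} {bot top : List (Strand (E × ℕ))}
    {o : Option (Node V E)} (h : SliceLift k s bot top o) : top.map proj = s.cod := by
  obtain ⟨hp⟩ := h
  simp [hp.map_cod]

namespace Lift

variable {k : ℕ} {b : List (Strand (E × ℕ))} {ns : List (Node V E)}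

theorem le_idx (h : Lift k b w ns) : ∀ n ∈ ns, k ≤ n.idx := by
  induction h with
  | nil => simp
  | cons hs _ ih =>
    obtain ⟨hp⟩ := hs
    cases hp with
    | cap | virt => simpa using fun n hn => (Nat.le_succ _).trans (ih n hn)
    | node => simpa using fun n hn => (Nat.le_succ _).trans (ih n hn)

theorem idx_nodup (h : Lift k b w ns) : (ns.map Node.idx).Nodup := by
  induction h with
  | nil => simp
  | cons hs hl ih =>
    obtain ⟨hp⟩ := hs
    cases hp with
    | cap | virt => simpa using ih
    | node =>
      simpa [ih] using fun n hn => (Nat.lt_of_succ_le (hl.le_idx n hn)).ne'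

theorem forall₂_vertexData_stars (h : Lift k b w ns) :
    List.Forall₂ (fun a c => a.1 = c.1 ∧ a.2.reverse ~r c.2) (vertexData ns) (stars w) := by
  induction h with
  | nil => exact .nil
  | cons hs _ ih =>
    obtain ⟨hp⟩ := hs
    cases hp with
    | cap | virt => exact ih
    | node hκ hd hc =>
      cases hκ with
      | cup | cross => exact ih
      | vertex v below above =>
        refine .cons ⟨rfl, ?_⟩ ih
        obtain rfl : _ = below := hd
        obtain rfl : _ = above := hc
        simpa [Function.comp_def] using List.isRotated_append

theorem map_fst_vertexData (h : Lift k b w ns) :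
    (vertexData ns).map Prod.fst = (stars w).map Prod.fst := by
  rw [← List.forall₂_eq_eq_eq, List.forall₂_map_left_iff, List.forall₂_map_right_iff]
  exact h.forall₂_vertexData_stars.imp fun _ _ h => h.1

theorem exists_star (h : Lift k b w ns) {v : V} {os : List (Strand E)}
    (hv : (v, os) ∈ vertexData ns) : ∃ hs, (v, hs) ∈ stars w ∧ os.reverse ~r hs := by
  obtain ⟨i, hi, hvi⟩ := List.getElem_of_mem hv
  have hi' : i < (stars w).length := h.forall₂_vertexData_stars.length_eq ▸ hi
  obtain ⟨hfst, hrot⟩ := h.forall₂_vertexData_stars.get hi hi'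
  simp only [List.get_eq_getElem, hvi] at hfst hrot
  refine ⟨(stars w)[i].2, ?_, hrot⟩
  rw [hfst]
  exact List.getElem_mem hi'

end Lift

theorem NodeTrace.backward {ns : List (Node V E)} {W : E → List Letter}
    (hadm : ∀ n ∈ ns, n.Admissible) (hnd : (ports ns).Nodup)
    (hinj : ∀ n ∈ ns, ∀ n' ∈ ns, ∀ v v', n.kind = .vert v → n'.kind = .vert v' →
      ∀ x ∈ n.outs, ∀ x' ∈ n'.outs, proj x = proj x' → x = x')
    (hstart : ∀ e, ∃ n ∈ ns, ∃ v, n.kind = .vert v ∧ ∃ x ∈ n.outs, proj x = (e, true) ∧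
      NodeTrace ns x (W e))
    {z : Strand (E × ℕ)} {l : List Letter} (h : NodeTrace ns z l) (hz : z.2 = false) :
    ∃ l', NodeTrace ns (rev z) l' := by
  induction h with
  | @finish n v z hn hv hx =>
    obtain ⟨n', hn', v', hv', x, hx', hproj, hl⟩ := hstart z.1.1
    obtain rfl : rev z = x := by
      refine hinj n hn n' hn' v v' hv hv' _ hx _ hx' ?_
      rw [hproj]
      simp [rev, mapStrand, hz]
    exact ⟨_, hl⟩
  | @pass n z y m _ hn hp _ ih =>
    have hy : y.2 = false := by
      simpa [mapStrand, rev, hz] using congrArg Prod.snd (hp.proj_eq (hadm n hn))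
    obtain ⟨l', hl'⟩ := ih hy
    obtain ⟨l'', -, hl''⟩ := hl'.of_pass hnd hn (by simpa using hp.symm)
    exact ⟨l'', hl''⟩

/-- The labelled nodes `ns` describe the diagram `D`, whose edges have the Gauss words `W`. -/
structure IsDiagramCode {G : DirectedGraph V E} (D : Diagram G) (ns : List (Node V E))
    (W : E → List Letter) : Prop extends IsCode ns W where
  normalForm : NormalForm ns D.word
  idx_nodup : (ns.map Node.idx).Nodup
  vert_nodup : ((vertexData ns).map Prod.fst).Nodup
  vert_mem : ∀ v, ∃ os, (v, os) ∈ vertexData ns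
  vert_star : ∀ v os, (v, os) ∈ vertexData ns → ∃ hs, (v, hs) ∈ stars D.word ∧ os.reverse ~r hs
  ne_cup : ∀ n ∈ ns, n.kind ≠ .cup

section Diagram

variable {G : DirectedGraph V E} {D : Diagram G} {ns : List (Node V E)} {W : E → List Letter}
  {lev : ℕ → List (Strand (E × ℕ))} {o : ℕ → Option (Node V E)} {k : ℕ}
  {bot : List (Strand (E × ℕ))}

theorem Lift.vert_nodup (hl : Lift k bot D.word ns) : ((vertexData ns).map Prod.fst).Nodup :=
  hl.map_fst_vertexData ▸ D.vertex_nodup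

theorem Lift.vert_mem (hl : Lift k bot D.word ns) (v : V) : ∃ os, (v, os) ∈ vertexData ns := by
  obtain ⟨hs, hv⟩ := D.vertex_mem v
  have hmem : v ∈ (vertexData ns).map Prod.fst :=
    hl.map_fst_vertexData ▸ List.mem_map_of_mem hv
  simpa using hmem

theorem Lift.vert_inj (hl : Lift k bot D.word ns) : ∀ n ∈ ns, ∀ n' ∈ ns, ∀ v v',
    n.kind = .vert v → n'.kind = .vert v' → ∀ x ∈ n.outs, ∀ x' ∈ n'.outs, proj x = proj x' →
      x = x' := by
  have star {n : Node V E} (hn : n ∈ ns) {v : V} (hv : n.kind = .vert v) :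
      (n.outs.map proj).Nodup ∧ ∀ x ∈ n.outs, G.foot (proj x) = v := by
    obtain ⟨hs, hmem, hrot⟩ := hl.exists_star (mem_vertexData.2 ⟨n, hn, hv, rfl⟩)
    refine ⟨List.nodup_reverse.1 (hrot.nodup_iff.2 (D.star_nodup v hs hmem)), fun x hx => ?_⟩
    exact (D.star_mem v hs hmem _).1
      (hrot.mem_iff.1 (List.mem_reverse.2 (List.mem_map_of_mem hx)))
  intro n hn n' hn' v v' hv hv' x hx x' hx' hproj
  obtain rfl : v = v' := by rw [← (star hn hv).2 x hx, ← (star hn' hv').2 x' hx', hproj]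
  obtain rfl := vert_unique hl.vert_nodup hn hn' hv hv'
  exact List.inj_on_of_nodup_map (star hn hv).1 hx hx' hproj

theorem Levels.exists_start (hlev : Levels 0 w ns lev o) (hbot : lev 0 = []) {e : E}
    {l : List Letter} (h : EdgeTrace w e l) : ∃ n ∈ ns, ∃ v, n.kind = .vert v ∧
      ∃ x ∈ n.outs, proj x = (e, true) ∧ NodeTrace ns x l := by
  have at_vertex {k : ℕ} {v : V} {left below above right : List (Strand E)}
      (hs : w[k]? = some ⟨left, .vertex v below above, right⟩) :
      ∃ l r d c, ∃ n ∈ ns, lev k = l ++ (d ++ r) ∧ lev (k + 1) = l ++ (c ++ r) ∧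
        l.length = left.length ∧ d.map proj = below ∧ c.map proj = above ∧
        n.kind = .vert v ∧ n.outs = (d.map rev).reverse ++ c := by
    obtain ⟨l, r, d, c, hleft, hbelow, habove, hp⟩ := (hlev.slice k _ hs).exists_pieceLift
    generalize ho : o k = o' at hp
    cases hp with
    | node hκ hd hc =>
      cases hκ
      exact ⟨l, r, d, c, _, hlev.mem k _ ho, hbelow, habove, by simp [show left = _ from hleft],
        hd, hc, rfl, rfl⟩
  cases h with
  | @up k i v left below above right _ hs hi ht =>
    obtain ⟨l, r, d, c, n, hn, -, htop, hlen, -, rfl, hv, houts⟩ := at_vertex hs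
    rw [List.getElem?_map, Option.map_eq_some_iff] at hi
    obtain ⟨x, hx, hproj⟩ := hi
    refine ⟨n, hn, v, hv, x, by simp [houts, List.mem_of_getElem? hx], hproj, ?_⟩
    refine hlev.nodeTrace hbot ht (x := x) ?_
    have hi := (List.getElem?_eq_some_iff.1 hx).1
    rw [if_pos rfl, htop, ← hlen, List.getElem?_append_right (by omega),
      List.getElem?_append_left (by omega)]
    simpa using hx
  | @down k i v left below above right _ hs hi ht =>
    obtain ⟨l, r, d, c, n, hn, hbelow, -, hlen, rfl, -, hv, houts⟩ := at_vertex hs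
    rw [List.getElem?_map, Option.map_eq_some_iff] at hi
    obtain ⟨x, hx, hproj⟩ := hi
    refine ⟨n, hn, v, hv, rev x, ?_, congrArg rev hproj, ?_⟩
    · rw [houts]
      exact List.mem_append_left _
        (List.mem_reverse.2 (List.mem_map_of_mem (List.mem_of_getElem? hx)))
    refine hlev.nodeTrace hbot ht (x := x) ?_
    have hi := (List.getElem?_eq_some_iff.1 hx).1
    rw [if_neg (by simp), hbelow, ← hlen, List.getElem?_append_right (by omega),
      List.getElem?_append_left (by omega)]
    simpa using hx

theorem Levels.exists_nodeTrace (hlev : Levels 0 D.word ns lev o) (hbot : lev 0 = []) {i : ℕ}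
    (hi : i < D.word.length) {x : Strand (E × ℕ)} (hx : x ∈ lev (i + 1)) :
    ∃ l, NodeTrace ns x l := by
  obtain ⟨j, hj, rfl⟩ := List.getElem_of_mem hx
  have hcod := (hlev.slice i _ (List.getElem?_eq_getElem hi)).map_cod
  obtain ⟨l, hl⟩ := D.no_circle i _ (List.getElem?_eq_getElem hi) j (by simpa [← hcod] using hj)
  exact ⟨l, hlev.nodeTrace hbot hl (by simp)⟩

theorem Levels.total (hlev : Levels 0 D.word ns lev o) (hbot : lev 0 = [])
    (hback : ∀ z l, NodeTrace ns z l → z.2 = false → ∃ l', NodeTrace ns (rev z) l') :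
    ∀ x ∈ ports ns, x.2 = true → ∃ l, NodeTrace ns x l := by
  intro x hx hdir
  obtain ⟨n, hn, hx⟩ := mem_ports.1 hx
  obtain ⟨i, s, hs, ho⟩ := hlev.exists_of_mem n hn
  have hi : i < D.word.length := (List.getElem?_eq_some_iff.1 hs).1
  obtain hbelow | habove : rev x ∈ lev i ∨ x ∈ lev (i + 1) := by
    obtain ⟨l, r, d, c, -, hbelow, habove, hp⟩ := (hlev.slice i s hs).exists_pieceLift
    rw [ho] at hp
    generalize s.piece = p at hp
    cases hp with
    | node =>
      rcases List.mem_append.1 hx with hx | hx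
      · obtain ⟨y, hy, rfl⟩ := List.mem_map.1 (List.mem_reverse.1 hx)
        exact .inl (by rw [hbelow, rev_rev]; simp [hy])
      · exact .inr (by rw [habove]; simp [hx])
  · rcases i with _ | i
    · simp [hbot] at hbelow
    · obtain ⟨l, hl⟩ := hlev.exists_nodeTrace hbot (Nat.lt_of_succ_lt hi) hbelow
      simpa using hback _ l hl (by simp [rev, hdir])
  · exact hlev.exists_nodeTrace hbot hi habove

theorem Diagram.exists_code (D : Diagram G) (hW : ∀ e, EdgeTrace D.word e (W e)) :
    ∃ ns, IsDiagramCode D ns W := by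
  obtain ⟨bot, ns, hnil, hl, hnd⟩ := Lift.exists_of_fits D.fits 0
  obtain rfl : bot = [] := by simpa using hnil
  obtain ⟨lev, o, hbot, hlev⟩ := hl.exists_levels
  have hstart e := hlev.exists_start hbot (hW e)
  have hcode : IsCode ns W := ⟨hl.admissible, hnd, hl.vert_inj, hstart,
    hlev.total hbot fun _ _ => NodeTrace.backward hl.admissible hnd hl.vert_inj hstart⟩
  obtain ⟨ns', hcode', hnf, hcup, hdata, hidx⟩ := hcode.remove_cups hl.normalForm
  exact ⟨ns', hcode', hnf, hl.idx_nodup.sublist hidx, hdata ▸ hl.vert_nodup, hdata ▸ hl.vert_mem,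
    fun v os h => hl.exists_star (hdata ▸ h), hcup⟩

end Diagram

/-! ### Canonical labels -/

section Trace

variable {ns ns' : List (Node V E)} {W : E → List Letter} {n : Node V E} {x x' y : Strand (E × ℕ)}
  {l l' : List Letter} {e : E}

theorem Pass.exists_letter {m : Option Letter} (h : Pass n x y m) (hk : n.kind ≠ .cup) :
    ∃ a : Letter, m = some a ∧ a.name = n.idx := by
  cases h <;> simp_all

theorem NodeTrace.exists_of_nil (hcup : ∀ n ∈ ns, n.kind ≠ .cup) (h : NodeTrace ns x []) :
    ∃ n ∈ ns, ∃ v, n.kind = .vert v ∧ rev x ∈ n.outs := by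
  generalize hq : [] = q at h
  cases h with
  | finish hn hv hx => exact ⟨_, hn, _, hv, hx⟩
  | pass hn hp _ =>
    obtain ⟨a, rfl, -⟩ := hp.exists_letter (hcup _ hn)
    simp at hq

theorem NodeTrace.exists_of_cons (hcup : ∀ n ∈ ns, n.kind ≠ .cup) {a : Letter}
    (h : NodeTrace ns x (a :: l)) :
    ∃ n ∈ ns, ∃ y, Pass n (rev x) y (some a) ∧ NodeTrace ns y l := by
  generalize hq : a :: l = q at h
  cases h with
  | finish => simp at hq
  | pass hn hp h =>
    obtain ⟨a', rfl, -⟩ := hp.exists_letter (hcup _ hn)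
    obtain ⟨rfl, rfl⟩ : a = a' ∧ l = _ := by simpa using hq
    exact ⟨_, hn, _, hp, h⟩

theorem NodeTrace.exists_of_suffix (hadm : ∀ n ∈ ns, n.Admissible)
    (hcup : ∀ n ∈ ns, n.kind ≠ .cup) (h : NodeTrace ns x l) (hl : l' <:+ l) :
    ∃ y, NodeTrace ns y l' ∧ proj y = proj x := by
  obtain ⟨p, rfl⟩ := hl
  induction p generalizing x with
  | nil => exact ⟨x, h, rfl⟩
  | cons a p ih =>
    obtain ⟨n, hn, y, hp, hy⟩ := h.exists_of_cons hcup
    obtain ⟨z, hz, hzy⟩ := ih hy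
    exact ⟨z, hz, by rw [hzy, hp.proj_eq (hadm n hn)]; simp⟩

namespace IsCode

theorem trace_inj (hc : IsCode ns W) (hcup : ∀ n ∈ ns, n.kind ≠ .cup) (hx : NodeTrace ns x l)
    (hx' : NodeTrace ns x' l') (hproj : proj x = proj x') (hlen : l.length = l'.length) :
    x = x' := by
  induction l generalizing x x' l' with
  | nil =>
    obtain rfl := List.length_eq_zero_iff.1 hlen.symm
    obtain ⟨n, hn, v, hv, hx⟩ := hx.exists_of_nil hcup
    obtain ⟨n', hn', v', hv', hx'⟩ := hx'.exists_of_nil hcup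
    simpa using congrArg rev
      (hc.vert_inj n hn n' hn' v v' hv hv' _ hx _ hx' (congrArg rev hproj))
  | cons a l ih =>
    obtain _ | ⟨a', l'⟩ := l'
    · simp at hlen
    obtain ⟨n, hn, y, hp, hy⟩ := hx.exists_of_cons hcup
    obtain ⟨n', hn', y', hp', hy'⟩ := hx'.exists_of_cons hcup
    have hyy' : proj y = proj y' := by
      rw [hp.proj_eq (hc.admissible n hn), hp'.proj_eq (hc.admissible n' hn')]
      simp [hproj]
    obtain rfl := ih hy hy' hyy' (by simpa using hlen)
    obtain rfl := node_unique hc.nodup hn hn' hp.right_mem hp'.right_mem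
    simpa using congrArg rev (hp.symm.unique (outs_nodup hc.nodup hn) hp'.symm).1

theorem length_le (hc : IsCode ns W) (hcup : ∀ n ∈ ns, n.kind ≠ .cup) (hx : NodeTrace ns x l)
    (hxe : proj x = (e, true)) : l.length ≤ (W e).length := by
  by_contra! hlt
  obtain ⟨n, hn, v, hv, s, hs, hse, hst⟩ := hc.start e
  obtain ⟨y, hy, hyx⟩ := hx.exists_of_suffix hc.admissible hcup
    (List.drop_suffix (l.length - ((W e).length + 1)) l)
  obtain ⟨a, q, haq⟩ := List.exists_cons_of_length_eq_add_one (n := (W e).length)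
    (show (l.drop (l.length - ((W e).length + 1))).length = _ by rw [List.length_drop]; omega)
  have hq : q.length = (W e).length := by
    simpa [Nat.sub_sub_self (Nat.succ_le_of_lt hlt)] using (congrArg List.length haq).symm
  rw [haq] at hy
  obtain ⟨n', hn', z, hp, hz⟩ := hy.exists_of_cons hcup
  have hzs : proj z = proj s := by
    rw [hp.proj_eq (hc.admissible n' hn'), hse, ← hxe, ← hyx]
    simp
  obtain rfl := hc.trace_inj hcup hz hst hzs hq
  obtain rfl := node_unique hc.nodup hn hn' hs hp.right_mem
  exact hp.kind_ne v hv

theorem suffix (hc : IsCode ns W) (hcup : ∀ n ∈ ns, n.kind ≠ .cup) (hx : NodeTrace ns x l)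
    (hxe : proj x = (e, true)) : l <:+ W e := by
  obtain ⟨-, -, -, -, s, -, hse, hst⟩ := hc.start e
  have hle := hc.length_le hcup hx hxe
  have hdrop := List.drop_suffix ((W e).length - l.length) (W e)
  obtain ⟨y, hy, hys⟩ := hst.exists_of_suffix hc.admissible hcup hdrop
  obtain rfl : x = y := hc.trace_inj hcup hx hy (by rw [hxe, hys, hse])
    (by rw [List.length_drop]; omega)
  rwa [hx.unique hc.nodup hy]

theorem exists_same_trace (hc : IsCode ns W) (hc' : IsCode ns' W)
    (hcup : ∀ n ∈ ns, n.kind ≠ .cup) (hcup' : ∀ n ∈ ns', n.kind ≠ .cup) (hx : NodeTrace ns x l)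
    (hdir : x.2 = true) : ∃ x', NodeTrace ns' x' l ∧ proj x' = proj x := by
  have hxe : proj x = (x.1.1, true) := Prod.ext rfl hdir
  obtain ⟨-, -, -, -, s, -, hse, hst⟩ := hc'.start x.1.1
  rw [hxe, ← hse]
  exact hst.exists_of_suffix hc'.admissible hcup' (hc.suffix hcup hx hxe)

end IsCode

open Classical in
/-- The number of crossings met from the label `a` to the end of its edge. -/
noncomputable def depth (ns : List (Node V E)) (a : E × ℕ) : ℕ :=
  if h : ∃ l, NodeTrace ns (a, true) l then h.choose.length else 0

theorem depth_eq (hnd : (ports ns).Nodup) {a : E × ℕ} (h : NodeTrace ns (a, true) l) :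
    depth ns a = l.length := by
  have hex : ∃ l, NodeTrace ns (a, true) l := ⟨l, h⟩
  rw [depth, dif_pos hex, h.unique hnd hex.choose_spec]

/-- The canonical label at the place of the label `a`: its edge, and the number of crossings up to
the end of the edge.  It depends only on the code, not on the labelling it is read off from. -/
noncomputable def label (ns : List (Node V E)) (a : E × ℕ) : E × ℕ := (a.1, depth ns a)

theorem mapStrand_label_eq (hnd : (ports ns).Nodup) (h : NodeTrace ns x l) (hdir : x.2 = true) :
    mapStrand (label ns) x = ((x.1.1, l.length), true) := by
  obtain ⟨a, _⟩ := x
  obtain rfl := hdir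
  simp [mapStrand, label, depth_eq hnd h]

theorem mapStrand_label_congr (hnd : (ports ns).Nodup) (hnd' : (ports ns').Nodup)
    (h : NodeTrace ns x l) (h' : NodeTrace ns' x' l) (hproj : proj x' = proj x)
    (hdir : x.2 = true) : mapStrand (label ns') x' = mapStrand (label ns) x := by
  obtain ⟨he, hdir'⟩ := Prod.ext_iff.1 hproj
  rw [mapStrand_label_eq hnd h hdir, mapStrand_label_eq hnd' h' (hdir'.trans hdir)]
  exact congrArg (fun e => ((e, l.length), true)) he

end Trace

namespace IsDiagramCode

variable {G : DirectedGraph V E} {D D' : Diagram G} {ns ns' : List (Node V E)}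
  {W : E → List Letter} {n : Node V E} {x y : Strand (E × ℕ)}

theorem rev_mem (hc : IsDiagramCode D ns W) (hx : x ∈ ports ns) : rev x ∈ ports ns := by
  obtain ⟨M, hM, hf, -⟩ := hc.normalForm
  exact hM.rev_mem hf hx

theorem exists_trace (hc : IsDiagramCode D ns W) (hx : x ∈ ports ns) :
    ∃ l, NodeTrace ns (x.1, true) l := by
  obtain ⟨a, _ | _⟩ := x
  · exact hc.total _ (hc.rev_mem hx) rfl
  · exact hc.total _ hx rfl

theorem nodup_label (hc : IsDiagramCode D ns W) :
    ((ports ns).map (mapStrand (label ns))).Nodup := by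
  refine List.Nodup.map_on ?_ hc.nodup
  rintro x hx y hy hxy
  obtain ⟨l, hl⟩ := hc.exists_trace hx
  obtain ⟨l', hl'⟩ := hc.exists_trace hy
  simp only [mapStrand, label, Prod.mk.injEq, depth_eq hc.nodup hl, depth_eq hc.nodup hl'] at hxy
  obtain ⟨⟨hedge, hlen⟩, hdir⟩ := hxy
  have hxy := hc.trace_inj hc.ne_cup hl hl' (by simp [mapStrand, hedge]) hlen
  exact Prod.ext (Prod.ext_iff.1 hxy).1 hdir

theorem match_pass (hc : IsDiagramCode D ns W) (hc' : IsDiagramCode D' ns' W) (hn : n ∈ ns)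
    {m : Letter} (hp : Pass n x y (some m)) (hx : x.2 = false) :
    ∃ n' ∈ ns', ∃ x' y', Pass n' x' y' (some m) ∧
      mapStrand (label ns') x' = mapStrand (label ns) x ∧
      mapStrand (label ns') y' = mapStrand (label ns) y := by
  have hyx := hp.proj_eq (hc.admissible n hn)
  have hy : y.2 = true := by simpa [mapStrand, rev, hx] using congrArg Prod.snd hyx
  obtain ⟨l, hl⟩ := hc.total y (mem_ports.2 ⟨n, hn, hp.right_mem⟩) hy
  have hxl : NodeTrace ns (rev x) (m :: l) :=
    NodeTrace.pass (x := rev x) (m := some m) hn (by simpa using hp) hl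
  have hdir : (rev x).2 = true := by simp [rev, hx]
  obtain ⟨z, hz, hzx⟩ := hc.exists_same_trace hc'.toIsCode hc.ne_cup hc'.ne_cup hxl hdir
  obtain ⟨n', hn', y', hp', hy'⟩ := hz.exists_of_cons hc'.ne_cup
  have hyy' : proj y' = proj y := by
    rw [hp'.proj_eq (hc'.admissible n' hn'), hyx]
    simp [hzx]
  refine ⟨n', hn', rev z, y', hp', ?_, mapStrand_label_congr hc.nodup hc'.nodup hl hy' hyy' hy⟩
  simpa using congrArg rev (mapStrand_label_congr hc.nodup hc'.nodup hxl hz hzx hdir)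

end IsDiagramCode

/-! ### Redrawing nodes -/

theorem Converts.rotate (k k' : ℕ) (v : V) (os : List (Strand (E × ℕ))) (i : ℕ) :
    Converts [(⟨k, .vert v, os.rotate i⟩ : Node V E)] [⟨k', .vert v, os⟩] := by
  have reindex {k k' : ℕ} (os : List (Strand (E × ℕ))) :
      Converts [(⟨k, .vert v, os⟩ : Node V E)] [⟨k', .vert v, os⟩] :=
    ⟨[], by simp, by simp, by
      simpa [nodesWord] using Eqv.refl (Kind.Admits.fits (k := .vert v) trivial)⟩
  induction i with
  | zero => simpa using reindex os
  | succ i ih =>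
    refine .trans ?_ ih
    rw [← List.rotate_rotate]
    rcases os.rotate i with _ | ⟨z, zs⟩
    · simpa using reindex []
    · simpa using Converts.rotate_vertex v z zs

theorem Converts.of_isRotated {k k' : ℕ} {v : V} {os os' : List (Strand (E × ℕ))}
    (h : os ~r os') : Converts [(⟨k, .vert v, os⟩ : Node V E)] [⟨k', .vert v, os'⟩] := by
  obtain ⟨i, rfl⟩ := h.symm
  exact .rotate k k' v os' i

section Redraw

variable {n n' n'' : Node V E} {k : ℕ} {t : CrossingType} {a b c d x x' y y' : Strand (E × ℕ)}
  {m : Option Letter} {s : Bool}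

theorem admissible_crs_iff : (⟨k, .crs t, [a, b, c, d]⟩ : Node V E).Admissible ↔
    t ≠ .virt ∧ proj a = rev (proj c) ∧ proj b = rev (proj d) := by
  refine and_congr_right fun _ => ⟨?_, fun h => ⟨proj d, proj c, ?_⟩⟩
  · rintro ⟨x, y, h⟩
    simp only [List.map_cons, List.map_nil, List.cons.injEq, and_true] at h
    obtain ⟨ha, hb, hc, hd⟩ := h
    rw [ha, hb, hc, hd]
    exact ⟨rfl, rfl⟩
  · simp [h]

namespace Node.Admissible

theorem exists_outs (h : n.Admissible) (hk : n.kind = .crs t) :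
    ∃ a b c d, n = ⟨n.idx, .crs t, [a, b, c, d]⟩ := by
  obtain ⟨k, κ, outs⟩ := n
  obtain rfl : κ = .crs t := hk
  obtain ⟨-, x, y, h⟩ := h
  simp only [List.map_eq_cons_iff, List.map_eq_nil_iff] at h
  obtain ⟨a, _, rfl, -, b, _, rfl, -, c, _, rfl, -, d, _, rfl, -, rfl⟩ := h
  exact ⟨a, b, c, d, rfl⟩

theorem rotate (h : (⟨k, .crs t, [a, b, c, d]⟩ : Node V E).Admissible) :
    (⟨k, .crs t.flip, [b, c, d, a]⟩ : Node V E).Admissible := by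
  obtain ⟨ht, hac, hbd⟩ := admissible_crs_iff.1 h
  exact admissible_crs_iff.2 ⟨by cases t <;> simp_all [CrossingType.flip], hbd, by simp [hac]⟩

end Node.Admissible

theorem Pass.rotate (h : (⟨k, .crs t, [a, b, c, d]⟩ : Node V E).Admissible)
    (hp : Pass (⟨k, .crs t, [a, b, c, d]⟩ : Node V E) x y m) :
    Pass (⟨k, .crs t.flip, [b, c, d, a]⟩ : Node V E) x y m := by
  obtain ⟨ht, hac, -⟩ := admissible_crs_iff.1 h
  have hflip : (t.flip == .upper) = !(t == .upper) := by
    cases t <;> simp_all [CrossingType.flip]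
  have hdir : a.2 = !c.2 := congrArg Prod.snd hac
  have hsign : ((!(t == .upper)) == (a.2 == d.2)) = ((t == .upper) == (d.2 == c.2)) := by
    rw [hdir]
    cases (t == .upper) <;> cases c.2 <;> cases d.2 <;> rfl
  cases hp
  · simpa [hflip, hsign] using @Pass.cross_ac V E k t.flip b c d a
  · simpa [hflip, hsign] using @Pass.cross_ca V E k t.flip b c d a
  · simpa [hflip, hsign] using @Pass.cross_db V E k t.flip b c d a
  · simpa [hflip, hsign] using @Pass.cross_bd V E k t.flip b c d a

/-- `n'` is another drawing of the node `n`: each can be converted into the other, and strands pass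
through them alike. -/
structure Redraws (n n' : Node V E) : Prop where
  admissible : n'.Admissible
  converts : Converts [n] [n']
  converts_symm : Converts [n'] [n]
  pass : ∀ {x y m}, Pass n x y m → Pass n' x y m

namespace Redraws

theorem refl (h : n.Admissible) : Redraws n n :=
  ⟨h, .refl (by simpa using h), .refl (by simpa using h), id⟩

theorem trans (h : Redraws n n') (h' : Redraws n' n'') : Redraws n n'' :=
  ⟨h'.admissible, h.converts.trans h'.converts, h'.converts_symm.trans h.converts_symm,
    fun hp => h'.pass (h.pass hp)⟩

theorem rotate (h : (⟨k, .crs t, [a, b, c, d]⟩ : Node V E).Admissible) :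
    Redraws (⟨k, .crs t, [a, b, c, d]⟩ : Node V E) ⟨k, .crs t.flip, [b, c, d, a]⟩ := by
  refine ⟨h.rotate, ?_, .rotate_crossing h, .rotate h⟩
  have rotate₂ := Converts.rotate_crossing (k' := k) h.rotate
  have rotate₃ := Converts.rotate_crossing (k' := k) h.rotate.rotate
  have rotate₄ := Converts.rotate_crossing (k' := k) h.rotate.rotate.rotate
  simp only [CrossingType.flip_flip] at rotate₂ rotate₃ rotate₄
  exact rotate₄.trans (rotate₃.trans rotate₂)

theorem rotate_rotate (h : (⟨k, .crs t, [a, b, c, d]⟩ : Node V E).Admissible) :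
    Redraws (⟨k, .crs t, [a, b, c, d]⟩ : Node V E) ⟨k, .crs t, [c, d, a, b]⟩ := by
  simpa using (rotate h).trans (rotate h.rotate)

end Redraws

theorem Node.Admissible.exists_upper (h : n.Admissible) (hk : n.kind = .crs t) :
    ∃ a b c d, Redraws n ⟨n.idx, .crs .upper, [a, b, c, d]⟩ ∧ b.2 = false := by
  obtain ⟨a, b, c, d, hn⟩ : ∃ a b c d,
      Redraws n ⟨n.idx, .crs .upper, [a, b, c, d]⟩ := by
    obtain ⟨a, b, c, d, hn⟩ := h.exists_outs hk
    rw [hn] at h ⊢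
    cases t with
    | upper => exact ⟨a, b, c, d, .refl h⟩
    | lower => exact ⟨b, c, d, a, .rotate h⟩
    | virt => exact absurd rfl h.1
  rcases hb : b.2 with _ | _
  · exact ⟨a, b, c, d, hn, hb⟩
  · have hdir : b.2 = !d.2 := congrArg Prod.snd (admissible_crs_iff.1 hn.admissible).2.2
    exact ⟨c, d, a, b, hn.trans (.rotate_rotate hn.admissible), by simpa [hb] using hdir⟩

theorem Pass.redraws (h : n.Admissible) (hover : Pass n x y (some ⟨k, true, s⟩))
    (hunder : Pass n x' y' (some ⟨k, false, s⟩)) (hx : x.2 = false) (hx' : x'.2 = false) :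
    Redraws n ⟨k, .crs .upper, if s then [x', x, y', y] else [y', x, x', y]⟩ := by
  generalize ho : (some ⟨k, true, s⟩ : Option Letter) = o at hover
  generalize hu : (some ⟨k, false, s⟩ : Option Letter) = u at hunder
  obtain ⟨t, hk⟩ : ∃ t, n.kind = .crs t := by
    cases hover <;> simp at ho ⊢
  obtain ⟨a, b, c, d, hn, hb⟩ := h.exists_upper hk
  obtain ⟨-, hac, hbd⟩ := admissible_crs_iff.1 hn.admissible
  have hac : a.2 = !c.2 := congrArg Prod.snd hac
  have hbd : b.2 = !d.2 := congrArg Prod.snd hbd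
  replace hover := hn.pass hover
  replace hunder := hn.pass hunder
  generalize n.idx = i at hn hover hunder
  cases hover <;> cases hunder <;> simp_all

end Redraw

/-! ### Diagrams with the same code -/

theorem NodeTrace.map {ns : List (Node V E)} {x : Strand (E × ℕ)} {l : List Letter}
    (hl : NodeTrace ns x l) (f : ℕ → ℕ) (h : E × ℕ → E × ℕ) :
    NodeTrace (ns.map (Node.map f h)) (mapStrand h x) (l.map (Letter.rename f)) := by
  induction hl with
  | finish hn hv hx => exact .finish (List.mem_map_of_mem hn) hv (List.mem_map_of_mem hx)
  | @pass n x y m l hn hp _ ih =>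
    have hpass := NodeTrace.pass (x := mapStrand h x) (List.mem_map_of_mem hn) (hp.map f h) ih
    cases m <;> simpa using hpass

@[simp] theorem mapStrand_id : (mapStrand id : Strand E → Strand E) = id := rfl

/-- The canonical label of an end of an edge at a vertex. -/
def endLabel (W : E → List Letter) (x : Strand E) : Strand (E × ℕ) :=
  ((x.1, if x.2 then (W x.1).length else 0), x.2)

/-- What the node stands for: a vertex, or the name of a crossing. -/
def Node.key (n : Node V E) : V ⊕ ℕ :=
  match n.kind with
  | .vert v => .inl v
  | _ => .inr n.idx

theorem Node.key_eq_inl {n : Node V E} {v : V} : n.key = .inl v ↔ n.kind = .vert v := by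
  rcases n with ⟨k, _ | _ | _, outs⟩ <;> simp [Node.key]

theorem Node.idx_of_key_eq {n : Node V E} {i : ℕ} (h : n.key = .inr i) : n.idx = i := by
  rcases n with ⟨k, _ | _ | _, outs⟩
  · simp [Node.key] at h
  all_goals simpa [Node.key] using h

theorem Pass.key_eq {n : Node V E} {x y : Strand (E × ℕ)} {m : Option Letter}
    (h : Pass n x y m) : n.key = .inr n.idx := by
  cases h <;> rfl

section Admissible

variable {n : Node V E} {x y : Strand (E × ℕ)} {m : Option Letter} {t : CrossingType}

theorem Pass.exists_incoming (hn : n.Admissible) (h : Pass n x y m) :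
    ∃ x' y', Pass n x' y' m ∧ x'.2 = false := by
  rcases hx : x.2 with _ | _
  · exact ⟨x, y, h, hx⟩
  · exact ⟨y, x, h.symm, by simpa [mapStrand, rev, hx] using congrArg Prod.snd (h.proj_eq hn)⟩

theorem Node.Admissible.exists_pass (hn : n.Admissible) (hk : n.kind = .crs t) :
    ∃ s, ∀ o, ∃ x y, Pass n x y (some ⟨n.idx, o, s⟩) ∧ x.2 = false := by
  obtain ⟨a, b, c, d, hout⟩ := hn.exists_outs hk
  refine ⟨(t == .upper) == (d.2 == c.2), fun o => ?_⟩
  suffices ∃ x y, Pass n x y (some ⟨n.idx, o, (t == .upper) == (d.2 == c.2)⟩) by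
    obtain ⟨x, y, h⟩ := this
    exact h.exists_incoming hn
  rw [hout]
  obtain rfl | rfl : o = (t == .upper) ∨ o = !(t == .upper) := by
    simpa only [Bool.eq_not] using em _
  · exact ⟨b, d, .cross_bd⟩
  · exact ⟨a, c, .cross_ac⟩

end Admissible

namespace IsDiagramCode

variable {G : DirectedGraph V E} {D D' : Diagram G} {ns ns' : List (Node V E)}
  {W : E → List Letter} {n n' : Node V E} {x : Strand (E × ℕ)}

theorem rename (hc : IsDiagramCode D ns W) {f : ℕ → ℕ} (hf : f.Injective) :
    IsDiagramCode D (ns.map (Node.map f id)) fun e => (W e).map (Letter.rename f) where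
  toIsCode := hc.toIsCode.map (fun _ => rfl) (fun _ => id) (fun _ hn _ _ => hn)
    (by simpa using hc.nodup) fun _ _ hl => hl.map f id
  normalForm := hc.normalForm.map f fun _ => rfl
  idx_nodup := by
    simpa [Function.comp_def, Node.map] using hc.idx_nodup.map hf
  vert_nodup := vertexData_map (h := id) ns f (fun _ => rfl) ▸ hc.vert_nodup
  vert_mem := vertexData_map (h := id) ns f (fun _ => rfl) ▸ hc.vert_mem
  vert_star := vertexData_map (h := id) ns f (fun _ => rfl) ▸ hc.vert_star
  ne_cup := List.forall_mem_map.2 hc.ne_cup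

theorem label_vert (hc : IsDiagramCode D ns W) (hn : n ∈ ns) {v : V} (hv : n.kind = .vert v)
    (hx : x ∈ n.outs) : mapStrand (label ns) x = endLabel W (proj x) := by
  obtain ⟨a, _ | _⟩ := x
  · obtain ⟨l, hl⟩ := hc.exists_trace (mem_ports.2 ⟨n, hn, hx⟩)
    obtain rfl := hl.of_vert hc.nodup hn hv hx
    simp [mapStrand, label, endLabel, depth_eq hc.nodup hl]
  · obtain ⟨n', hn', v', hv', x', hx', hxe, hl⟩ := hc.start a.1
    obtain rfl := hc.vert_inj n hn n' hn' v v' hv hv' _ hx _ hx' hxe.symm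
    simp [mapStrand, label, endLabel, depth_eq hc.nodup hl]

theorem map_label_vert (hc : IsDiagramCode D ns W) (hn : n ∈ ns) {v : V}
    (hv : n.kind = .vert v) :
    n.outs.map (mapStrand (label ns)) = (n.outs.map proj).map (endLabel W) := by
  rw [List.map_map]
  exact List.map_congr_left fun x hx => hc.label_vert hn hv hx

theorem key_inj (hc : IsDiagramCode D ns W) (hn : n ∈ ns) (hn' : n' ∈ ns)
    (h : n.key = n'.key) : n = n' := by
  rcases hk : n.key with v | i
  · exact vert_unique hc.vert_nodup hn hn' (Node.key_eq_inl.1 hk) (Node.key_eq_inl.1 (h ▸ hk))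
  · refine List.inj_on_of_nodup_map hc.idx_nodup hn hn' ?_
    exact (Node.idx_of_key_eq hk).trans (Node.idx_of_key_eq (h ▸ hk)).symm

theorem exists_converts_of_vert (hc : IsDiagramCode D ns W) (hc' : IsDiagramCode D' ns' W)
    (hrot : ∀ v hs hs', (v, hs) ∈ stars D.word → (v, hs') ∈ stars D'.word → hs ~r hs')
    (hn : n ∈ ns) {v : V} (hv : n.kind = .vert v) : ∃ n' ∈ ns', n'.key = n.key ∧
      Converts [n.map id (label ns)] [n'.map id (label ns')] := by
  obtain ⟨os', hos'⟩ := hc'.vert_mem v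
  obtain ⟨hs', hmem', hrot'⟩ := hc'.vert_star v os' hos'
  obtain ⟨n', hn', hv', rfl⟩ := mem_vertexData.1 hos'
  obtain ⟨hs, hmem, hrot₁⟩ := hc.vert_star v _ (mem_vertexData.2 ⟨n, hn, hv, rfl⟩)
  refine ⟨n', hn', (Node.key_eq_inl.2 hv').trans (Node.key_eq_inl.2 hv).symm, ?_⟩
  have hproj : n.outs.map proj ~r n'.outs.map proj := by
    simpa using ((hrot₁.trans (hrot v hs hs' hmem hmem')).trans hrot'.symm).reverse
  have hlabel := hproj.map (endLabel W)
  rw [← hc.map_label_vert hn hv, ← hc'.map_label_vert hn' hv'] at hlabel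
  simpa only [Node.map, hv, hv'] using Converts.of_isRotated hlabel

theorem exists_converts_of_crs (hc : IsDiagramCode D ns W) (hc' : IsDiagramCode D' ns' W)
    (hn : n ∈ ns) {t : CrossingType} (ht : n.kind = .crs t) : ∃ n' ∈ ns', n'.key = n.key ∧
      Converts [n.map id (label ns)] [n'.map id (label ns')] := by
  have hadm := hc.admissible n hn
  obtain ⟨s, hs⟩ := hadm.exists_pass ht
  obtain ⟨x, y, hover, hx⟩ := hs true
  obtain ⟨x', y', hunder, hx'⟩ := hs false
  obtain ⟨n₁, hn₁, z, w, hover', hzx, hwy⟩ := hc.match_pass hc' hn hover hx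
  obtain ⟨n₂, hn₂, z', w', hunder', hzx', hwy'⟩ := hc.match_pass hc' hn hunder hx'
  have key_eq {n' z w o} (hn' : n' ∈ ns') (h : Pass n' z w (some ⟨n.idx, o, s⟩)) :
      n'.key = n.key := by
    obtain ⟨a, ha, hidx⟩ := h.exists_letter (hc'.ne_cup n' hn')
    obtain rfl := Option.some.inj ha
    rw [h.key_eq, hover.key_eq, ← hidx]
  obtain rfl := hc'.key_inj hn₁ hn₂ ((key_eq hn₁ hover').trans (key_eq hn₂ hunder').symm)
  refine ⟨n₁, hn₁, key_eq hn₁ hover', ?_⟩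
  have hredraw := (hover.map id (label ns)).redraws (hadm.map id (h := label ns) fun _ => rfl)
    (hunder.map id (label ns)) hx hx'
  have hredraw' := (hover'.map id (label ns')).redraws
    ((hc'.admissible n₁ hn₁).map id (h := label ns') fun _ => rfl) (hunder'.map id (label ns'))
    (by rw [hzx]; exact hx) (by rw [hzx']; exact hx')
  rw [hzx, hwy, hzx', hwy'] at hredraw'
  exact hredraw.converts.trans hredraw'.converts_symm

theorem exists_converts (hc : IsDiagramCode D ns W) (hc' : IsDiagramCode D' ns' W)
    (hrot : ∀ v hs hs', (v, hs) ∈ stars D.word → (v, hs') ∈ stars D'.word → hs ~r hs')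
    (hn : n ∈ ns) : ∃ n' ∈ ns', n'.key = n.key ∧
      Converts [n.map id (label ns)] [n'.map id (label ns')] := by
  rcases hk : n.kind with v | t | _
  · exact hc.exists_converts_of_vert hc' hrot hn hk
  · exact hc.exists_converts_of_crs hc' hn hk
  · exact absurd hk (hc.ne_cup n hn)

theorem exists_perm (hc : IsDiagramCode D ns W) (hc' : IsDiagramCode D' ns' W)
    (hrot : ∀ v hs hs', (v, hs) ∈ stars D.word → (v, hs') ∈ stars D'.word → hs ~r hs') :
    ∃ φ : Node V E → Node V E, (ns.map φ).Perm ns' ∧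
      ∀ n ∈ ns, Converts [n.map id (label ns)] [(φ n).map id (label ns')] := by
  have hexists (n) (hn : n ∈ ns) := hc.exists_converts hc' hrot hn
  have : Nonempty (Node V E) := ⟨⟨0, .cup, []⟩⟩
  choose! φ hmem hkey hconv using hexists
  refine ⟨φ, (List.perm_ext_iff_of_nodup ?_ hc'.idx_nodup.of_map).2 fun n' => ⟨?_, fun hn' => ?_⟩,
    hconv⟩
  · refine hc.idx_nodup.of_map.map_on fun n hn m hm h => hc.key_inj hn hm ?_
    rw [← hkey n hn, ← hkey m hm, h]
  · simpa only [List.mem_map, forall_exists_index, and_imp] using fun n hn h => h ▸ hmem n hn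
  · obtain ⟨n, hn, hnn', -⟩ := hc'.exists_converts hc
      (fun v hs hs' h h' => (hrot v hs' hs h' h).symm) hn'
    exact List.mem_map.2 ⟨n, hn, hc'.key_inj (hmem n hn) hn' ((hkey n hn).trans hnn')⟩

theorem eqv (hc : IsDiagramCode D ns W) (hc' : IsDiagramCode D' ns' W)
    (hrot : ∀ v hs hs', (v, hs) ∈ stars D.word → (v, hs') ∈ stars D'.word → hs ~r hs') :
    Eqv [] [] D.word D'.word := by
  obtain ⟨φ, hperm, hconv⟩ := hc.exists_perm hc' hrot
  have hadm' : ∀ n ∈ ns'.map (Node.map id (label ns')), n.Admissible :=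
    List.forall_mem_map.2 fun n hn => (hc'.admissible n hn).map id fun _ => rfl
  have hadm : ∀ n ∈ (ns.map φ).map (Node.map id (label ns')), n.Admissible := fun n hn =>
    hadm' n ((hperm.map _).mem_iff.1 hn)
  have hnodes : Converts (ns.map (Node.map id (label ns)))
      ((ns.map φ).map (Node.map id (label ns'))) := by
    refine .of_forall₂ ?_
    rw [List.forall₂_map_left_iff, List.map_map, List.forall₂_map_right_iff, List.forall₂_same]
    exact fun n hn => ⟨hconv n hn, hadm _ (List.mem_map_of_mem (List.mem_map_of_mem hn))⟩
  have hnf := hc.normalForm.map id (h := label ns) fun _ => rfl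
  have hnf' := hc'.normalForm.map id (h := label ns') fun _ => rfl
  refine NormalForm.eqv ?_ ((hnf.converts hnodes).converts (.of_perm (hperm.map _) hadm)) hnf' hadm'
  rw [ports_map]
  exact hc'.nodup_label

end IsDiagramCode

namespace Diagram.HasGaussCode

variable {G : DirectedGraph V E} {D D' : Diagram G} {S : GaussCode V E}

theorem exists_code (h : D.HasGaussCode S) : ∃ ns, IsDiagramCode D ns S.word := by
  obtain ⟨⟨f, hf, hW⟩, -⟩ := h
  choose W hW hS using hW
  obtain ⟨ns, hc⟩ := D.exists_code hW
  exact ⟨_, (funext hS : S.word = fun e => (W e).map (Letter.rename f)) ▸ hc.rename hf⟩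

theorem virtuallyEquivalent (h : D.HasGaussCode S) (h' : D'.HasGaussCode S) :
    VirtuallyEquivalent D D' := by
  obtain ⟨ns, hc⟩ := h.exists_code
  obtain ⟨ns', hc'⟩ := h'.exists_code
  exact (hc.eqv hc' fun v hs hs' hv hv' =>
    Cycle.coe_eq_coe.1 ((h.2 v hs hv).symm.trans (h'.2 v hs' hv'))).eqvGen_move

end Diagram.HasGaussCode

end VirtualGraph

theorem mainTheorem5 {V E : Type*} (G : VirtualGraph.DirectedGraph V E)
    (D : VirtualGraph.Diagram G) (S : VirtualGraph.GaussCode V E)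
    (hS : D.HasGaussCode S) (hr : S.Realizable G) :
    ∃ D' : VirtualGraph.Diagram G, D'.IsClassical ∧ VirtualGraph.VirtuallyEquivalent D D' := by
  obtain ⟨D', hD', hS'⟩ := hr
  exact ⟨D', hD', hS.virtuallyEquivalent hS'⟩
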